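/- Let $X$ be a complex manifold of dimension $n$, and let $\Phi\in A^{0,1}(X,T^{1,0}_X)$ be a smooth Beltrami differential, written locally as $\Phi=\sum_i\Phi^i\otimes\frac{\partial}{\partial z^i}$ with $(0,1)$-forms $\Phi^i$. Suppose that $\Phi$ is integrable, i.e. $\overline\partial\Phi=\frac12[\Phi,\Phi]$, where $[\Phi,\Phi]=2\sum_{i,j}\Phi^i\wedge\partial_i\Phi^j\otimes\frac{\partial}{\partial z^j}$ and $\partial_i$ differentiates the coefficients of $\Phi^j$ with respect to $z^i$. Suppose also that $\Phi$ induces an almost complex structure $J_\Phi$ on $X$ whose $(1,0)$-covectors are spanned by the $dz^i+\Phi^i$, i.e. that the $dz^i+\Phi^i$ and their conjugates together span the complexified cotangent space at each point. (This applies to $\Phi=\Phi(t)$ for each fixed parameter $t$ of a family of such Beltrami differentials, with $X_t=(X,J_{\Phi(t)})$.) Let $\Phi\lrcorner\alpha=i_\Phi\alpha=\sum_i\Phi^i\wedge\big(\frac{\partial}{\partial z^i}\lrcorner\,\alpha\big)$ and $e^{\Phi}\lrcorner\alpha=\sum_{k\ge0}\frac1{k!}\,i_\Phi^k\alpha$ (a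 finite sum). Then for every smooth $(n,0)$-form $\Omega$ on $X$, the form $e^{\Phi}\lrcorner\Omega$ is a smooth form of type $(n,0)$ with respect to $J_\Phi$. It is holomorphic with respect to $J_\Phi$, i.e. $\overline\partial_{J_\Phi}(e^\Phi\lrcorner\Omega)=0$, where $\overline\partial_{J_\Phi}$ of an $(n,0)$-form $\beta$ is the $(n,1)$-part of $d\beta$ with respect to $J_\Phi$, if and only if $$\overline\partial\,\Omega+\partial(\Phi\lrcorner\Omega)=0 .$$ -/

import Mathlib

open scoped Manifold ContDiff Topology

noncomputable section

namespace CplxDeform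

/-! ### Linear algebra on one tangent space

`E` is a complex vector space, seen as a real tangent space with its complex structure.  Complex
valued `k`-forms are real-multilinear alternating maps `E [⋀^Fin k]→L[ℝ] ℂ`. -/

section Pointwise

variable {E : Type*} [NormedAddCommGroup E] [NormedSpace ℂ E]

/-- Multiplication by `i`, the standard complex structure of the real vector space `E`. -/
def stdJ : E →L[ℝ] E := Complex.I • ContinuousLinearMap.id ℝ E

/-- The circle action `v ↦ cos θ · v + sin θ · J v` attached to a complex structure `J`: it is
multiplication by `exp (i θ)` for the complex vector space `(E, J)`. -/
def rot (J : E →L[ℝ] E) (θ : ℝ) : E →L[ℝ] E :=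
  Real.cos θ • ContinuousLinearMap.id ℝ E + Real.sin θ • J

/-- `α` is of type `(p, q)` with respect to `J`: its degree is `p + q`, and since `exp (i θ)` acts
on `J`-complex-linear covectors by `exp (i θ)` and on `J`-antilinear ones by `exp (- i θ)`, the
`(p, q)`-forms are those on which it acts by `exp (i (p - q) θ)`. -/
def IsOfType (J : E →L[ℝ] E) (p q : ℕ) {k : ℕ} (α : E [⋀^Fin k]→L[ℝ] ℂ) : Prop :=
  p + q = k ∧ ∀ θ : ℝ, α.compContinuousLinearMap (rot J θ) =
    Complex.exp (((p : ℂ) - (q : ℂ)) * θ * Complex.I) • α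

/-- The `(p, q)`-component, with respect to `J`, of a form `α` of degree `k = p + q`: the
Fourier component of weight `p - q` of `α` under the circle action. -/
def typeProj (J : E →L[ℝ] E) (p q : ℕ) {k : ℕ} (α : E [⋀^Fin k]→L[ℝ] ℂ) :
    E [⋀^Fin k]→L[ℝ] ℂ :=
  (2 * Real.pi)⁻¹ • ∫ θ in (0 : ℝ)..(2 * Real.pi),
    Complex.exp (-(((p : ℂ) - (q : ℂ)) * θ * Complex.I)) • α.compContinuousLinearMap (rot J θ)

/-- The contraction `v ↦ i_{φ(v)} α`.  A real vector `w` stands for the vector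
`(w - i J w) / 2` of type `(1, 0)`, and `α` is extended complex-linearly to complex vectors. -/
def contractVec (φ : E →L[ℝ] E) {k : ℕ} (α : E [⋀^Fin (k + 1)]→L[ℝ] ℂ) :
    E →L[ℝ] E [⋀^Fin k]→L[ℝ] ℂ :=
  (1 / 2 : ℂ) • (α.curryLeft.comp φ - Complex.I • α.curryLeft.comp (stdJ.comp φ))

/-- The contraction `i_φ α = φ ⌟ α` with a `T^{1,0}`-valued one-form `φ = ∑ φⁱ ⊗ ∂ᵢ`, that is
`∑ φⁱ ∧ (∂ᵢ ⌟ α)`; it is zero on functions. -/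
def contract (φ : E →L[ℝ] E) : {k : ℕ} → (E [⋀^Fin k]→L[ℝ] ℂ) → (E [⋀^Fin k]→L[ℝ] ℂ)
  | 0, _ => 0
  | _ + 1, α => ContinuousAlternatingMap.alternatizeUncurryFin (contractVec φ α)

/-- `exp (i_φ) α = ∑ⱼ (1 / j!) (i_φ)ʲ α`.  On `k`-forms the terms with `j > k` vanish, because
each contraction (with an antilinear `φ`) lowers the holomorphic degree by one. -/
def expContract (φ : E →L[ℝ] E) {k : ℕ} (α : E [⋀^Fin k]→L[ℝ] ℂ) : E [⋀^Fin k]→L[ℝ] ℂ :=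
  ∑ j ∈ Finset.range (k + 1), ((j.factorial : ℝ)⁻¹) • ((contract φ)^[j] α)

/-- `φ` induces a complex structure: the covectors `ℓ ∘ (1 + φ)`, `ℓ` complex-linear (that is,
the `dzⁱ + φⁱ`), and their conjugates together span all complex covectors. -/
def Nondegenerate (φ : E →L[ℝ] E) : Prop :=
  (ContinuousLinearMap.id ℝ E + φ).IsInvertible

/-- The complex structure `J_φ = (1 + φ)⁻¹ ∘ i ∘ (1 + φ)` induced by `φ`: the one whose
`(1, 0)`-covectors are the `ℓ ∘ (1 + φ)` with `ℓ` complex-linear, i.e. are spanned by the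
`dzⁱ + φⁱ`. -/
def inducedJ (φ : E →L[ℝ] E) : E →L[ℝ] E :=
  (ContinuousLinearMap.id ℝ E + φ).inverse.comp
    (stdJ.comp (ContinuousLinearMap.id ℝ E + φ))

/-- The map `1 + φ` is complex-linear from `(E, J_φ)` to `E`. -/
theorem one_add_comp_inducedJ {φ : E →L[ℝ] E} (h : Nondegenerate φ) :
    (ContinuousLinearMap.id ℝ E + φ).comp (inducedJ φ) =
      stdJ.comp (ContinuousLinearMap.id ℝ E + φ) := by
  obtain ⟨e, he⟩ := h
  rw [inducedJ, ← he, ContinuousLinearMap.inverse_equiv]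
  ext v
  simp

/-- `J_φ` is a complex structure. -/
theorem inducedJ_comp_inducedJ {φ : E →L[ℝ] E} (h : Nondegenerate φ) :
    (inducedJ φ).comp (inducedJ φ) = -ContinuousLinearMap.id ℝ E := by
  obtain ⟨e, he⟩ := h
  rw [inducedJ, ← he, ContinuousLinearMap.inverse_equiv]
  ext v
  simp [stdJ, smul_smul]

end Pointwise

/-! ### Forms and Beltrami differentials on a complex manifold

`X` is a complex manifold modelled on `E`.  The tangent space of `X` at `x` is `E`, through the
preferred chart at `x`; `tangentCoordChange 𝓘(ℂ, E) x y p` is the change of coordinates of tangent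
vectors at `p` from the chart at `x` to the chart at `y`.  It is complex-linear, so that the
complex structure of `X` on each tangent space is multiplication by `i` on `E`. -/

section Manifold

variable {E : Type*} [NormedAddCommGroup E] [NormedSpace ℂ E]
  {X : Type*} [TopologicalSpace X] [ChartedSpace E X] [IsManifold 𝓘(ℂ, E) ω X]

/-- The coordinate change of tangent vectors at `p`, as a real-linear map. -/
def coordChange (x y p : X) : E →L[ℝ] E :=
  (tangentCoordChange 𝓘(ℂ, E) x y p).restrictScalars ℝ

/-- The expression of a `k`-form in the preferred chart at `x`. -/
def formInChart (x : X) {k : ℕ} (α : X → E [⋀^Fin k]→L[ℝ] ℂ) : E → E [⋀^Fin k]→L[ℝ] ℂ :=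
  fun y => (α ((extChartAt 𝓘(ℂ, E) x).symm y)).compContinuousLinearMap
    (coordChange x ((extChartAt 𝓘(ℂ, E) x).symm y) ((extChartAt 𝓘(ℂ, E) x).symm y))

/-- `α` is a smooth complex-valued `k`-form on `X`. -/
def IsSmoothForm {k : ℕ} (α : X → E [⋀^Fin k]→L[ℝ] ℂ) : Prop :=
  ∀ x : X, ContDiffOn ℝ ∞ (formInChart x α) (extChartAt 𝓘(ℂ, E) x).target

/-- The exterior derivative of a `k`-form, computed at `x` in the chart at `x`. -/
def extD {k : ℕ} (α : X → E [⋀^Fin k]→L[ℝ] ℂ) : X → E [⋀^Fin (k + 1)]→L[ℝ] ℂ :=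
  fun x => extDeriv (formInChart x α) (extChartAt 𝓘(ℂ, E) x x)

/-- The operator `∂` of a field `J` of complex structures on the tangent spaces:
the sum over `p + q = k` of the `(p + 1, q)`-components of `d` on the `(p, q)`-components. -/
def del (J : X → E →L[ℝ] E) {k : ℕ} (α : X → E [⋀^Fin k]→L[ℝ] ℂ) :
    X → E [⋀^Fin (k + 1)]→L[ℝ] ℂ :=
  fun x => ∑ pq ∈ Finset.HasAntidiagonal.antidiagonal k,
    typeProj (J x) (pq.1 + 1) pq.2 (extD (fun y => typeProj (J y) pq.1 pq.2 (α y)) x)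

/-- The operator `∂̄` of a field `J` of complex structures on the tangent spaces:
the sum over `p + q = k` of the `(p, q + 1)`-components of `d` on the `(p, q)`-components. -/
def delbar (J : X → E →L[ℝ] E) {k : ℕ} (α : X → E [⋀^Fin k]→L[ℝ] ℂ) :
    X → E [⋀^Fin (k + 1)]→L[ℝ] ℂ :=
  fun x => ∑ pq ∈ Finset.HasAntidiagonal.antidiagonal k,
    typeProj (J x) pq.1 (pq.2 + 1) (extD (fun y => typeProj (J y) pq.1 pq.2 (α y)) x)

/-- `α` is a smooth form of type `(p, q)` with respect to `J`. -/
def IsSmoothFormOfType (J : X → E →L[ℝ] E) (p q : ℕ) {k : ℕ}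
    (α : X → E [⋀^Fin k]→L[ℝ] ℂ) : Prop :=
  IsSmoothForm α ∧ ∀ x, IsOfType (J x) p q (α x)

/-- `α` is a holomorphic `(p, 0)`-form with respect to `J`: smooth, of type `(p, 0)`, and
`∂̄`-closed, with type and `∂̄` taken with respect to `J`. -/
def IsHolomorphicForm (J : X → E →L[ℝ] E) {p : ℕ} (α : X → E [⋀^Fin p]→L[ℝ] ℂ) : Prop :=
  IsSmoothFormOfType J p 0 α ∧ ∀ x, delbar J α x = 0

/-- The expression in the preferred chart at `x` of a field of endomorphisms of the tangent
spaces. -/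
def endoInChart (x : X) (Φ : X → E →L[ℝ] E) : E → E →L[ℝ] E :=
  fun y =>
    let p : X := (extChartAt 𝓘(ℂ, E) x).symm y
    (coordChange p x p).comp ((Φ p).comp (coordChange x p p))

/-- `Φ` is a Beltrami differential, i.e. a smooth `(0, 1)`-form with values in the holomorphic
tangent bundle `T^{1,0}`.  The latter is identified with the tangent bundle as a complex vector
bundle (`w` corresponds to `(w - i J w) / 2`, so `∂ᵢ` to the `i`-th basis vector): `Φ` is a smooth
field of antilinear endomorphisms, with `v ↦ ∑ Φⁱ(v) ∂ᵢ` for `Φ = ∑ Φⁱ ⊗ ∂ᵢ`. -/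
def IsBeltrami (Φ : X → E →L[ℝ] E) : Prop :=
  (∀ x : X, ContDiffOn ℝ ∞ (endoInChart x Φ) (extChartAt 𝓘(ℂ, E) x).target) ∧
    ∀ (x : X) (v : E), Φ x (Complex.I • v) = -(Complex.I • Φ x v)

/-- In the chart at `x`, the derivative at `x` of the components of `Φ` along the `(1, 0)`-vector
`∑ wⁱ ∂ᵢ` given by `w`, applied to `v`. -/
def partialB (Φ : X → E →L[ℝ] E) (x : X) (w v : E) : E :=
  (1 / 2 : ℂ) • (fderiv ℝ (endoInChart x Φ) (extChartAt 𝓘(ℂ, E) x x) w v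
    - Complex.I • fderiv ℝ (endoInChart x Φ) (extChartAt 𝓘(ℂ, E) x x) (Complex.I • w) v)

/-- In the chart at `x`, the derivative at `x` of the components of `Φ` along the `(0, 1)`-part
of `w`, applied to `v`. -/
def partialBarB (Φ : X → E →L[ℝ] E) (x : X) (w v : E) : E :=
  (1 / 2 : ℂ) • (fderiv ℝ (endoInChart x Φ) (extChartAt 𝓘(ℂ, E) x x) w v
    + Complex.I • fderiv ℝ (endoInChart x Φ) (extChartAt 𝓘(ℂ, E) x x) (Complex.I • w) v)

/-- `∂̄Φ`, a `(0, 2)`-form with values in `T^{1,0}`, evaluated at `x` on `u, v`. -/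
def delbarB (Φ : X → E →L[ℝ] E) (x : X) (u v : E) : E :=
  partialBarB Φ x u v - partialBarB Φ x v u

/-- `[Φ, Ψ] = ∑ (Φⁱ ∧ ∂ᵢΨʲ + Ψⁱ ∧ ∂ᵢΦʲ) ⊗ ∂ⱼ`, evaluated at `x` on `u, v`. -/
def bracketB (Φ Ψ : X → E →L[ℝ] E) (x : X) (u v : E) : E :=
  (partialB Ψ x (Φ x u) v - partialB Ψ x (Φ x v) u)
    + (partialB Φ x (Ψ x u) v - partialB Φ x (Ψ x v) u)

/-- The integrability condition `∂̄Φ = ½ [Φ, Φ]`. -/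
def IsIntegrable (Φ : X → E →L[ℝ] E) : Prop :=
  ∀ (x : X) (u v : E), delbarB Φ x u v = (1 / 2 : ℂ) • bracketB Φ Φ x u v

end Manifold

end CplxDeform

end

noncomputable section

namespace CplxDeform

open ContinuousAlternatingMap

section Pointwise

variable {E : Type*} [NormedAddCommGroup E] [NormedSpace ℂ E]

/-! The key remark is that `e^Φ ⌟ Ω` is the pointwise pullback of `Ω` by the real endomorphism `A =
1 + Φ` of the tangent bundle (`IsComplexMultilinear.expContract_eq`). Since `A` is complex-linear
from `(E, J_Φ)` to `E`, this pullback has type `(n, 0)` for `J_Φ`.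

Fix a point and a chart, and let `W`, `F` be the derivatives of `Ω`, `Φ` there. Expanding `d(A^* Ω)`
gives a term in `W` and a term in `F`. Write `W = (W'' - W' ∘ Φ) + W' ∘ A`, with `W'`, `W''` the
complex-linear and antilinear parts, and split `F` in the same way. The term `W' ∘ A` contributes
the pullback of the `(n + 1, 0)`-form `∂Ω`, which is zero in dimension `n`. Integrability says that
`F'' - F' ∘ Φ` is a symmetric bilinear map, so alternatization kills it. What remains is `Alt (A^* ∘
G)`, where `G` is `obstruction`, an antilinear family of `(n, 0)`-forms
(`alternatize_pullback_deriv`). The same family satisfies `∂̄Ω + ∂(Φ ⌟ Ω) = Alt G`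
(`alternatize_antiPart_add_alternatize_linPart_contractDeriv`).

Each of the two alternatizations vanishes exactly when `G = 0` (`alternatize_pullback_eq_zero_iff`).
For `Alt G` this is `eq_zero_of_alternatizeUncurryFin_eq_zero`. For the pullback, put `G = G' ∘ A`.
Then the antilinear part of `G'` vanishes, and antilinearity of `G = G' + G' ∘ Φ` forces its
complex-linear part `G'` to vanish too.

Types are handled through weights of the circle action: in fixed degree `p + q`, the weight `p - q`
determines the type. -/

@[simp]
theorem stdJ_apply (v : E) : stdJ v = Complex.I • v := rfl

theorem rot_apply (J : E →L[ℝ] E) (θ : ℝ) (v : E) :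
    rot J θ v = Real.cos θ • v + Real.sin θ • J v := rfl

theorem rot_stdJ_apply (θ : ℝ) (v : E) : rot stdJ θ v = Complex.exp (θ * Complex.I) • v := by
  rw [rot_apply, Complex.exp_mul_I, add_smul, stdJ_apply, mul_smul, ← Complex.ofReal_cos,
    ← Complex.ofReal_sin, Complex.coe_smul, Complex.coe_smul]

/-! #### Components of a form of mixed type -/

/-- `α` is multiplied by `exp (i w θ)` under the circle action attached to `J`. -/
def HasWeight (J : E →L[ℝ] E) (w : ℤ) {k : ℕ} (α : E [⋀^Fin k]→L[ℝ] ℂ) : Prop :=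
  ∀ θ : ℝ, α.compContinuousLinearMap (rot J θ) = Complex.exp ((w : ℂ) * θ * Complex.I) • α

theorem isOfType_iff {J : E →L[ℝ] E} {p q k : ℕ} {α : E [⋀^Fin k]→L[ℝ] ℂ} :
    IsOfType J p q α ↔ p + q = k ∧ HasWeight J (p - q) α := by
  simp [IsOfType, HasWeight]

theorem HasWeight.zero (J : E →L[ℝ] E) (w : ℤ) {k : ℕ} :
    HasWeight J w (0 : E [⋀^Fin k]→L[ℝ] ℂ) := fun θ => by
  ext v; simp

theorem integral_exp_int_mul {m : ℤ} (hm : m ≠ 0) :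
    ∫ θ in (0 : ℝ)..(2 * Real.pi), Complex.exp ((m : ℂ) * θ * Complex.I) = 0 := by
  have hc : (m : ℂ) * Complex.I ≠ 0 := by simp [hm]
  have h := integral_exp_mul_complex (a := 0) (b := 2 * Real.pi) hc
  have h1 : Complex.exp ((m : ℂ) * Complex.I * ((2 * Real.pi : ℝ) : ℂ)) = 1 := by
    rw [Complex.exp_eq_one_iff]
    exact ⟨m, by push_cast; ring⟩
  rw [h1] at h
  simpa [mul_right_comm] using h

/-- Orthogonality of the characters of the circle: the integrand is constant on `α` and a nontrivial
character on `β`. -/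
theorem typeProj_add_of_hasWeight {J : E →L[ℝ] E} {p q k : ℕ} {w : ℤ}
    {α β : E [⋀^Fin k]→L[ℝ] ℂ} (hα : HasWeight J (p - q) α) (hβ : HasWeight J w β)
    (hw : w ≠ p - q) : typeProj J p q (α + β) = α := by
  have h : ∀ θ : ℝ, Complex.exp (-(((p : ℂ) - (q : ℂ)) * θ * Complex.I)) •
      (α + β).compContinuousLinearMap (rot J θ) =
      α + Complex.exp (((w - (p - q) : ℤ) : ℂ) * θ * Complex.I) • β := by
    intro θ
    have : (α + β).compContinuousLinearMap (rot J θ) = α.compContinuousLinearMap (rot J θ) +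
      β.compContinuousLinearMap (rot J θ) := rfl
    rw [this, hα θ, hβ θ, smul_add, smul_smul, smul_smul, ← Complex.exp_add, ← Complex.exp_add]
    push_cast
    rw [neg_add_cancel, Complex.exp_zero, one_smul]
    congr 3
    ring
  rw [typeProj]
  simp_rw [h]
  rw [intervalIntegral.integral_add (by simp) (Continuous.intervalIntegrable (by fun_prop) _ _),
    intervalIntegral.integral_smul_const, integral_exp_int_mul (sub_ne_zero.2 hw)]
  have hπ : (2 * Real.pi)⁻¹ * (2 * Real.pi) = 1 := inv_mul_cancel₀ (by positivity)
  simp only [intervalIntegral.integral_const, sub_zero, zero_smul, add_zero, smul_smul, hπ,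
    one_smul]

theorem typeProj_eq_self {J : E →L[ℝ] E} {p q k : ℕ} {α : E [⋀^Fin k]→L[ℝ] ℂ}
    (hα : HasWeight J (p - q) α) : typeProj J p q α = α := by
  -- The zero form has every weight, so any weight different from `p - q` serves for `β`.
  simpa using typeProj_add_of_hasWeight hα (HasWeight.zero J (p - q + 1)) (by simp)

theorem typeProj_eq_zero {J : E →L[ℝ] E} {p q k : ℕ} {w : ℤ} {β : E [⋀^Fin k]→L[ℝ] ℂ}
    (hβ : HasWeight J w β) (hw : w ≠ p - q) : typeProj J p q β = 0 := by
  simpa using typeProj_add_of_hasWeight (HasWeight.zero J (p - q)) hβ hw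

/-! #### Forms of type `(n, 0)` are complex multilinear -/

/-- `α` is complex-linear in each argument. -/
def IsComplexMultilinear {k : ℕ} (α : E [⋀^Fin k]→L[ℝ] ℂ) : Prop :=
  ∀ (v : Fin k → E) (i : Fin k) (w : E),
    α (Function.update v i (Complex.I • w)) = Complex.I * α (Function.update v i w)

/-- Applying `P j` to the relation reproduces it for `P j x` over the remaining indices, with `c +
1` in place of `c`. By induction those summands vanish, hence so does `(c + 1) • P j x`. The
constant `c` is there for this induction; the case of use is `c = 0`. -/
theorem eq_zero_of_sum_projections {M ι : Type*} [AddCommGroup M] [Module ℂ M]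
    (P : ι → M →ₗ[ℂ] M) (hP : ∀ i x, P i (P i x) = P i x)
    (hc : ∀ i j x, P i (P j x) = P j (P i x)) (s : Finset ι) :
    ∀ (x : M) (c : ℕ), ∑ i ∈ s, P i x = -((c : ℂ) • x) → ∀ i ∈ s, P i x = 0 := by
  classical
  induction s using Finset.induction_on with
  | empty => simp
  | insert j s hj ih =>
    intro x c hx
    rw [Finset.sum_insert hj] at hx
    have h1 : ∑ i ∈ s, P i (P j x) = -(((c + 1 : ℕ) : ℂ) • P j x) := by
      have := congrArg (P j) hx
      simp only [map_add, hP, _root_.map_sum, map_neg, map_smul, hc j] at this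
      rw [← eq_sub_iff_add_eq'] at this
      rw [this]
      push_cast
      module
    have h2 : P j x = 0 := by
      have h3 : ∑ i ∈ s, P i (P j x) = 0 := Finset.sum_eq_zero (ih _ _ h1)
      rw [h3, eq_comm, neg_eq_zero, smul_eq_zero] at h1
      exact h1.resolve_left (Nat.cast_ne_zero.2 (Nat.succ_ne_zero c))
    rw [h2, zero_add] at hx
    intro i hi
    rcases Finset.mem_insert.1 hi with rfl | hi
    · exact h2
    · exact ih x c hx i hi

/-- Infinitesimal form of the weight condition: differentiate it at `θ = 0`. -/
theorem HasWeight.sum_update {k : ℕ} {w : ℤ} {α : E [⋀^Fin k]→L[ℝ] ℂ} (hα : HasWeight stdJ w α)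
    (v : Fin k → E) :
    ∑ i, α (Function.update v i (Complex.I • v i)) = (w : ℂ) * Complex.I * α v := by
  have hg : HasDerivAt (fun θ : ℝ => fun i => rot stdJ θ (v i)) (fun i => Complex.I • v i) 0 := by
    rw [hasDerivAt_pi]
    intro i
    simp only [rot_apply]
    have h1 := (Real.hasDerivAt_cos 0).smul_const (v i)
    have h2 := (Real.hasDerivAt_sin 0).smul_const (stdJ (v i))
    simpa using! h1.add h2
  have h0 : (fun i => rot stdJ 0 (v i)) = v := by ext i; simp [rot_apply]
  have h1 := (α.hasFDerivAt (fun i => rot stdJ 0 (v i))).comp_hasDerivAt (0 : ℝ) hg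
  have h2 : HasDerivAt (fun θ : ℝ => Complex.exp ((w : ℂ) * θ * Complex.I) * α v)
      ((w : ℂ) * Complex.I * α v) 0 := by
    have := (((Complex.ofRealCLM.hasDerivAt (x := (0 : ℝ))).const_mul (w : ℂ)).mul_const
      Complex.I).cexp.mul_const (α v)
    simpa using this
  have h3 : (α ∘ fun θ : ℝ => fun i => rot stdJ θ (v i)) =
      fun θ : ℝ => Complex.exp ((w : ℂ) * θ * Complex.I) * α v := by
    ext θ
    exact DFunLike.congr_fun (hα θ) v
  rw [h3] at h1
  have := h1.unique h2
  rw [h0] at this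
  simpa [ContinuousMultilinearMap.linearDeriv_apply] using this

/-- Let `P i` project onto the part antilinear in slot `i`. The top weight `k` makes the sum of the
`P i α` vanish, and commuting projections with zero sum on `α` each kill `α`. -/
theorem HasWeight.isComplexMultilinear {k : ℕ} {α : E [⋀^Fin k]→L[ℝ] ℂ}
    (hα : HasWeight stdJ k α) : IsComplexMultilinear α := by
  classical
  -- Operators acting on a single slot do not preserve alternating maps, so the argument runs in all
  -- multilinear maps.
  let M := MultilinearMap ℝ (fun _ : Fin k => E) ℂ
  let T : Fin k → M →ₗ[ℂ] M := fun i =>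
    { toFun := fun g => g.compLinearMap
        (fun j => if j = i then (stdJ : E →L[ℝ] E).toLinearMap else LinearMap.id)
      map_add' := fun _ _ => rfl
      map_smul' := fun _ _ => rfl }
  have hT : ∀ i (g : M) v, T i g v = g (Function.update v i (Complex.I • v i)) := by
    intro i g v
    change g _ = g _
    congr 1
    ext j
    by_cases h : j = i
    · subst h; simp
    · simp [h]
  have hTT : ∀ i (g : M), T i (T i g) = -g := by
    intro i g
    ext v
    rw [hT, hT, Function.update_self, Function.update_idem, smul_smul, Complex.I_mul_I,
      neg_one_smul, g.map_update_neg, Function.update_eq_self]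
    rfl
  have hTc : ∀ i j (g : M), T i (T j g) = T j (T i g) := by
    intro i j g
    by_cases h : i = j
    · rw [h]
    ext v
    simp only [hT]
    rw [Function.update_of_ne (Ne.symm h), Function.update_of_ne h, Function.update_comm h]
  let P : Fin k → M →ₗ[ℂ] M := fun i => (1 / 2 : ℂ) • (LinearMap.id + Complex.I • T i)
  have hPa : ∀ i (g : M), P i g = (1 / 2 : ℂ) • (g + Complex.I • T i g) := fun _ _ => rfl
  have hI : ∀ g : M, Complex.I • Complex.I • g = -g := fun g => by
    rw [smul_smul, Complex.I_mul_I, neg_one_smul]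
  have hPP : ∀ i g, P i (P i g) = P i g := by
    intro i g
    simp only [hPa, map_smul, map_add, hTT]
    have h := smul_comm Complex.I (1 / 2 : ℂ) (T i g + Complex.I • -g)
    have h' : Complex.I • (T i g + Complex.I • -g) = Complex.I • T i g + g :=
      (smul_add _ _ _).trans (by rw [hI, neg_neg])
    rw [h, h']
    module
  have hPc : ∀ i j g, P i (P j g) = P j (P i g) := by
    intro i j g
    simp only [hPa, map_smul, map_add, hTc i j, smul_add]
    simp only [smul_comm Complex.I (1 / 2 : ℂ)]
    abel
  have hsum : ∑ i, P i (α.toMultilinearMap : M) = -(((0 : ℕ) : ℂ) • α.toMultilinearMap) := by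
    ext v
    have h := hα.sum_update v
    have h2 : ∀ i, P i (α.toMultilinearMap : M) v =
        (1 / 2 : ℂ) * (α v + Complex.I * α (Function.update v i (Complex.I • v i))) := by
      intro i
      rw [hPa, _root_.smul_apply, _root_.add_apply, _root_.smul_apply, hT]
      rfl
    rw [_root_.sum_apply]
    simp_rw [h2]
    rw [← Finset.mul_sum, Finset.sum_add_distrib, ← Finset.mul_sum, h]
    simp only [Finset.sum_const, Finset.card_univ, Fintype.card_fin, nsmul_eq_mul]
    push_cast
    change _ = -((0 : ℂ) * α v)
    linear_combination (1 / 2 * (k : ℂ) * α v) * Complex.I_mul_I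
  intro v i w
  have h0 := eq_zero_of_sum_projections P hPP hPc Finset.univ _ _ hsum i (Finset.mem_univ i)
  have h1 := DFunLike.congr_fun h0 (Function.update v i w)
  rw [hPa, _root_.smul_apply, _root_.add_apply, _root_.smul_apply, hT] at h1
  simp only [Function.update_self, Function.update_idem, _root_.zero_apply,
    smul_eq_mul] at h1
  change (1 / 2 : ℂ) * (α _ + Complex.I * α _) = 0 at h1
  linear_combination (-2 * Complex.I) * h1 +
    α (Function.update v i (Complex.I • w)) * Complex.I_mul_I

theorem IsComplexMultilinear.map_update_smul {k : ℕ} {α : E [⋀^Fin k]→L[ℝ] ℂ}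
    (hα : IsComplexMultilinear α) (v : Fin k → E) (i : Fin k) (c : ℂ) (w : E) :
    α (Function.update v i (c • w)) = c * α (Function.update v i w) := by
  have h : c • w = c.re • w + c.im • (Complex.I • w) := by
    conv_lhs => rw [← Complex.re_add_im c, add_smul, mul_smul, Complex.coe_smul, Complex.coe_smul]
  rw [h, α.map_update_add, α.map_update_smul, α.map_update_smul, hα]
  conv_rhs => rw [← Complex.re_add_im c]
  simp only [Complex.real_smul]
  ring

theorem IsComplexMultilinear.eq_zero [FiniteDimensional ℂ E] {k : ℕ} {α : E [⋀^Fin k]→L[ℝ] ℂ}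
    (hα : IsComplexMultilinear α) (hk : Module.finrank ℂ E < k) : α = 0 := by
  classical
  let β : E [⋀^Fin k]→ₗ[ℂ] ℂ :=
    { toFun := α
      map_update_add' := by
        intro _ v i x y
        convert α.map_update_add v i x y
      map_update_smul' := by
        intro _ v i c x
        rw [smul_eq_mul]
        convert hα.map_update_smul v i c x
      map_eq_zero_of_eq' := fun v i j h hij => α.map_eq_zero_of_eq v h hij }
  ext v
  refine β.map_linearDependent v fun h => ?_
  have := h.fintype_card_le_finrank
  simp at this
  omega

/-! #### Linear and antilinear parts of a real-linear map -/

section Parts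

variable {V : Type*} [NormedAddCommGroup V] [NormedSpace ℝ V] [NormedSpace ℂ V]
  [IsScalarTower ℝ ℂ V]

/-- The complex-linear part of a real-linear map. -/
def linPart (g : E →L[ℝ] V) : E →L[ℝ] V := (1 / 2 : ℂ) • (g - Complex.I • g.comp stdJ)

/-- The antilinear part of a real-linear map. -/
def antiPart (g : E →L[ℝ] V) : E →L[ℝ] V := (1 / 2 : ℂ) • (g + Complex.I • g.comp stdJ)

theorem linPart_apply (g : E →L[ℝ] V) (v : E) :
    linPart g v = (1 / 2 : ℂ) • (g v - Complex.I • g (Complex.I • v)) := rfl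

theorem antiPart_apply (g : E →L[ℝ] V) (v : E) :
    antiPart g v = (1 / 2 : ℂ) • (g v + Complex.I • g (Complex.I • v)) := rfl

theorem linPart_add_antiPart (g : E →L[ℝ] V) : linPart g + antiPart g = g := by
  ext v
  rw [_root_.add_apply, linPart_apply, antiPart_apply]
  module

theorem linPart_I_smul (g : E →L[ℝ] V) (v : E) :
    linPart g (Complex.I • v) = Complex.I • linPart g v := by
  simp only [linPart_apply, smul_smul, Complex.I_mul_I, neg_one_smul, _root_.map_neg, smul_sub,
    smul_neg]
  rw [show Complex.I * (1 / 2 * Complex.I) = -(1 / 2) by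
    linear_combination (1 / 2 : ℂ) * Complex.I_mul_I]
  module

theorem antiPart_I_smul (g : E →L[ℝ] V) (v : E) :
    antiPart g (Complex.I • v) = -(Complex.I • antiPart g v) := by
  simp only [antiPart_apply, smul_smul, Complex.I_mul_I, neg_one_smul, _root_.map_neg, smul_add,
    smul_neg]
  rw [show Complex.I * (1 / 2 * Complex.I) = -(1 / 2) by
    linear_combination (1 / 2 : ℂ) * Complex.I_mul_I]
  module

theorem map_exp_smul_of_linear {g : E →L[ℝ] V} (hg : ∀ v, g (Complex.I • v) = Complex.I • g v)
    (θ : ℝ) (v : E) :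
    g (Complex.exp (θ * Complex.I) • v) = Complex.exp (θ * Complex.I) • g v := by
  rw [← rot_stdJ_apply, rot_apply, map_add, map_smul, map_smul, stdJ_apply, hg,
    Complex.exp_mul_I, add_smul, mul_smul, ← Complex.ofReal_cos, ← Complex.ofReal_sin,
    ← Complex.coe_algebraMap, algebraMap_smul, algebraMap_smul]

theorem map_exp_smul_of_antilinear {g : E →L[ℝ] V}
    (hg : ∀ v, g (Complex.I • v) = -(Complex.I • g v)) (θ : ℝ) (v : E) :
    g (Complex.exp (θ * Complex.I) • v) = Complex.exp (-(θ * Complex.I)) • g v := by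
  rw [← rot_stdJ_apply, rot_apply, map_add, map_smul, map_smul, stdJ_apply, hg, ← neg_mul,
    Complex.exp_mul_I, add_smul, mul_smul, ← Complex.ofReal_neg, ← Complex.ofReal_cos,
    ← Complex.ofReal_sin, ← Complex.coe_algebraMap, algebraMap_smul, algebraMap_smul,
    Real.cos_neg, Real.sin_neg, neg_smul, smul_neg]

end Parts

/-! #### Alternatization -/

theorem alternatizeUncurryFin_compContinuousLinearMap {k : ℕ} (g : E →L[ℝ] E [⋀^Fin k]→L[ℝ] ℂ)
    (R : E →L[ℝ] E) :
    (alternatizeUncurryFin g).compContinuousLinearMap R =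
      alternatizeUncurryFin (compContinuousLinearMapCLM R ∘L g ∘L R) := by
  ext v
  simp +unfoldPartialApp [alternatizeUncurryFin_apply, Fin.removeNth, Function.comp_def]

theorem hasWeight_alternatizeUncurryFin {J : E →L[ℝ] E} {w : ℤ} {k : ℕ}
    {g : E →L[ℝ] E [⋀^Fin k]→L[ℝ] ℂ}
    (h : ∀ (θ : ℝ) v, (g (rot J θ v)).compContinuousLinearMap (rot J θ) =
      Complex.exp ((w : ℂ) * θ * Complex.I) • g v) : HasWeight J w (alternatizeUncurryFin g) := by
  intro θ
  rw [alternatizeUncurryFin_compContinuousLinearMap, ← alternatizeUncurryFin_smul]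
  congr 1
  ext1 v
  exact h θ v

theorem smul_compContinuousLinearMap {k : ℕ} (c : ℂ) (α : E [⋀^Fin k]→L[ℝ] ℂ) (R : E →L[ℝ] E) :
    (c • α).compContinuousLinearMap R = c • α.compContinuousLinearMap R := rfl

theorem hasWeight_alternatizeUncurryFin_linear {w : ℤ} {k : ℕ}
    {g : E →L[ℝ] E [⋀^Fin k]→L[ℝ] ℂ} (hg : ∀ v, g (Complex.I • v) = Complex.I • g v)
    (hw : ∀ v, HasWeight stdJ w (g v)) : HasWeight stdJ (w + 1) (alternatizeUncurryFin g) := by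
  refine hasWeight_alternatizeUncurryFin fun θ v => ?_
  rw [rot_stdJ_apply, map_exp_smul_of_linear hg, smul_compContinuousLinearMap, hw v θ, smul_smul,
    ← Complex.exp_add]
  push_cast
  congr 2
  ring

theorem hasWeight_alternatizeUncurryFin_antilinear {w : ℤ} {k : ℕ}
    {g : E →L[ℝ] E [⋀^Fin k]→L[ℝ] ℂ} (hg : ∀ v, g (Complex.I • v) = -(Complex.I • g v))
    (hw : ∀ v, HasWeight stdJ w (g v)) : HasWeight stdJ (w - 1) (alternatizeUncurryFin g) := by
  refine hasWeight_alternatizeUncurryFin fun θ v => ?_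
  rw [rot_stdJ_apply, map_exp_smul_of_antilinear hg, smul_compContinuousLinearMap, hw v θ,
    smul_smul, ← Complex.exp_add]
  push_cast
  congr 2
  ring

theorem HasWeight.add {J : E →L[ℝ] E} {w : ℤ} {k : ℕ} {α β : E [⋀^Fin k]→L[ℝ] ℂ}
    (hα : HasWeight J w α) (hβ : HasWeight J w β) : HasWeight J w (α + β) := fun θ => by
  rw [smul_add, ← hα θ, ← hβ θ]; rfl

theorem HasWeight.smul {J : E →L[ℝ] E} {w : ℤ} {k : ℕ} {α : E [⋀^Fin k]→L[ℝ] ℂ}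
    (hα : HasWeight J w α) (c : ℂ) : HasWeight J w (c • α) := fun θ => by
  rw [smul_comm, ← hα θ]; rfl

theorem HasWeight.sub {J : E →L[ℝ] E} {w : ℤ} {k : ℕ} {α β : E [⋀^Fin k]→L[ℝ] ℂ}
    (hα : HasWeight J w α) (hβ : HasWeight J w β) : HasWeight J w (α - β) := fun θ => by
  rw [smul_sub, ← hα θ, ← hβ θ]; rfl

theorem HasWeight.linPart {w : ℤ} {k : ℕ} {J : E →L[ℝ] E} {g : E →L[ℝ] E [⋀^Fin k]→L[ℝ] ℂ}
    (hg : ∀ v, HasWeight J w (g v)) (v : E) : HasWeight J w (linPart g v) :=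
  ((hg _).sub ((hg _).smul _)).smul _

theorem HasWeight.antiPart {w : ℤ} {k : ℕ} {J : E →L[ℝ] E} {g : E →L[ℝ] E [⋀^Fin k]→L[ℝ] ℂ}
    (hg : ∀ v, HasWeight J w (g v)) (v : E) : HasWeight J w (antiPart g v) :=
  ((hg _).add ((hg _).smul _)).smul _

theorem alternatizeUncurryFin_eq_linPart_add_antiPart {k : ℕ}
    (g : E →L[ℝ] E [⋀^Fin k]→L[ℝ] ℂ) :
    alternatizeUncurryFin g =
      alternatizeUncurryFin (linPart g) + alternatizeUncurryFin (antiPart g) := by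
  rw [← alternatizeUncurryFin_add, linPart_add_antiPart]

/-- A form of type `(n + 1, 0)` on a space of dimension `n` vanishes. -/
theorem alternatizeUncurryFin_linPart_eq_zero [FiniteDimensional ℂ E] {n : ℕ}
    (hn : Module.finrank ℂ E = n) {g : E →L[ℝ] E [⋀^Fin n]→L[ℝ] ℂ}
    (hg : ∀ v, HasWeight stdJ n (g v)) : alternatizeUncurryFin (linPart g) = 0 := by
  have h := hasWeight_alternatizeUncurryFin_linear (linPart_I_smul g) (HasWeight.linPart hg)
  have h' : HasWeight stdJ ((n + 1 : ℕ) : ℤ) (alternatizeUncurryFin (linPart g)) := by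
    simpa using h
  exact h'.isComplexMultilinear.eq_zero (by omega)

theorem IsComplexMultilinear.map_cons {k : ℕ} {α : E [⋀^Fin (k + 1)]→L[ℝ] ℂ}
    (hα : IsComplexMultilinear α) (x : E) (v : Fin k → E) :
    α (Matrix.vecCons (Complex.I • x) v) = Complex.I * α (Matrix.vecCons x v) := by
  have := hα (Matrix.vecCons x v) 0 x
  simpa [Matrix.vecCons] using this

/-- An antilinear family of `(n, 0)`-forms is determined by its alternatization. -/
theorem eq_zero_of_alternatizeUncurryFin_eq_zero {k : ℕ} {g : E →L[ℝ] E [⋀^Fin k]→L[ℝ] ℂ}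
    (hg : ∀ v, g (Complex.I • v) = -(Complex.I • g v)) (hm : ∀ v, IsComplexMultilinear (g v))
    (h : alternatizeUncurryFin g = 0) : g = 0 := by
  ext x u
  -- In the alternatization at `(y, u)`, the first term is antilinear in `y` and all the others are
  -- complex-linear in `y`. Comparing `y = x` with `y = i x` isolates the first.
  have key : ∀ y, g y u + ∑ i : Fin k, (-1) ^ ((i.succ : Fin (k + 1)) : ℕ) •
      g (u i) (i.succ.removeNth (Matrix.vecCons y u)) = 0 := by
    intro y
    have := DFunLike.congr_fun h (Matrix.vecCons y u)
    rw [alternatizeUncurryFin_apply, Fin.sum_univ_succ] at this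
    simpa using this
  have hlin : ∀ i : Fin k, g (u i) (i.succ.removeNth (Matrix.vecCons (Complex.I • x) u)) =
      Complex.I * g (u i) (i.succ.removeNth (Matrix.vecCons x u)) := by
    intro i
    cases k with
    | zero => exact i.elim0
    | succ k =>
      have hr : ∀ y : E, i.succ.removeNth (Matrix.vecCons y u) =
          Matrix.vecCons y (i.removeNth u) := by
        intro y
        ext j
        cases j using Fin.cases <;> simp [Fin.removeNth]
      rw [hr, hr, (hm (u i)).map_cons]
  have h1 := key x
  have h2 := key (Complex.I • x)
  simp_rw [hlin, hg] at h2
  simp_rw [← mul_smul_comm] at h2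
  rw [← Finset.mul_sum] at h2
  have h3 : (-(Complex.I • g x)) u = -(Complex.I * g x u) := rfl
  rw [h3] at h2
  change g x u = 0
  linear_combination (1 / 2 : ℂ) * h1 + (1 / 2 * Complex.I) * h2 - (1 / 2 : ℂ) *
    (- g x u + ∑ i : Fin k, (-1) ^ ((i.succ : Fin (k + 1)) : ℕ) •
      g (u i) (i.succ.removeNth (Matrix.vecCons x u))) * Complex.I_mul_I

/-! #### The derivation of forms induced by an endomorphism -/

/-- The sum `h + h.flip` is symmetric, and a symmetric bilinear map contributes nothing after
alternatization. -/
theorem alternatizeUncurryFin_fderivComp_swap {n : ℕ} (α : E [⋀^Fin n]→L[ℝ] ℂ) (A : E →L[ℝ] E)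
    (h : E →L[ℝ] E →L[ℝ] E) :
    alternatizeUncurryFin (α.fderivCompContinuousLinearMap A ∘L h) =
      -alternatizeUncurryFin (α.fderivCompContinuousLinearMap A ∘L h.flip) := by
  rw [eq_neg_iff_add_eq_zero, ← alternatizeUncurryFin_add, ← ContinuousLinearMap.comp_add]
  refine alternatizeUncurryFin_fderivCompContinuousLinearMap_eq_zero α A fun x y => ?_
  simp [add_comm]

theorem fderivComp_comp {n : ℕ} (α : E [⋀^Fin n]→L[ℝ] ℂ) (A B : E →L[ℝ] E) :
    α.fderivCompContinuousLinearMap A (B ∘L A) =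
      (α.fderivCompContinuousLinearMap (.id ℝ E) B).compContinuousLinearMap A := by
  ext v
  simp only [fderivCompContinuousLinearMap_apply, compContinuousLinearMap_apply]
  refine Finset.sum_congr rfl fun i _ => congrArg α (funext fun j => ?_)
  by_cases h : j = i
  · subst h; simp
  · simp [h]

theorem fderivComp_id_apply {n : ℕ} (α : E [⋀^Fin n]→L[ℝ] ℂ) (L : E →L[ℝ] E) (v : Fin n → E) :
    α.fderivCompContinuousLinearMap (.id ℝ E) L v = ∑ i, α (Function.update v i (L (v i))) := by
  rw [fderivCompContinuousLinearMap_apply]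
  refine Finset.sum_congr rfl fun i _ => congrArg α (funext fun j => ?_)
  by_cases h : j = i
  · subst h; simp
  · simp [h]

theorem fderivComp_id_comp {n : ℕ} (α : E [⋀^Fin n]→L[ℝ] ℂ) {L L' R : E →L[ℝ] E}
    (h : L ∘L R = R ∘L L') :
    (α.fderivCompContinuousLinearMap (.id ℝ E) L).compContinuousLinearMap R =
      (α.compContinuousLinearMap R).fderivCompContinuousLinearMap (.id ℝ E) L' := by
  ext v
  rw [compContinuousLinearMap_apply, fderivComp_id_apply, fderivComp_id_apply]
  refine Finset.sum_congr rfl fun i _ => congrArg α (funext fun j => ?_)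
  by_cases hj : j = i
  · subst hj; simpa using DFunLike.congr_fun h (v j)
  · simp [hj]

theorem IsComplexMultilinear.fderivComp_smul {n : ℕ} {α : E [⋀^Fin n]→L[ℝ] ℂ}
    (hα : IsComplexMultilinear α) (c : ℂ) (L : E →L[ℝ] E) :
    α.fderivCompContinuousLinearMap (.id ℝ E) (c • L) =
      c • α.fderivCompContinuousLinearMap (.id ℝ E) L := by
  ext v
  rw [fderivComp_id_apply, ContinuousAlternatingMap.smul_apply, fderivComp_id_apply,
    Finset.smul_sum]
  exact Finset.sum_congr rfl fun i _ => hα.map_update_smul v i c _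

theorem smul_fderivComp {n : ℕ} (α : E [⋀^Fin n]→L[ℝ] ℂ) (c : ℂ) (L : E →L[ℝ] E) :
    (c • α).fderivCompContinuousLinearMap (.id ℝ E) L =
      c • α.fderivCompContinuousLinearMap (.id ℝ E) L := by
  ext v
  rw [fderivComp_id_apply, ContinuousAlternatingMap.smul_apply, fderivComp_id_apply,
    Finset.smul_sum]
  rfl

theorem HasWeight.fderivComp_linear {n : ℕ} {w : ℤ} {α : E [⋀^Fin n]→L[ℝ] ℂ}
    (hα : HasWeight stdJ w α) {L : E →L[ℝ] E} (hL : ∀ v, L (Complex.I • v) = Complex.I • L v) :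
    HasWeight stdJ w (α.fderivCompContinuousLinearMap (.id ℝ E) L) := by
  intro θ
  rw [fderivComp_id_comp α (L' := L), hα θ, smul_fderivComp]
  ext v
  simp only [ContinuousLinearMap.comp_apply, rot_stdJ_apply]
  exact map_exp_smul_of_linear hL θ v

theorem HasWeight.fderivComp_antilinear {n : ℕ} {α : E [⋀^Fin n]→L[ℝ] ℂ}
    (hα : HasWeight stdJ n α) {L : E →L[ℝ] E}
    (hL : ∀ v, L (Complex.I • v) = -(Complex.I • L v)) :
    HasWeight stdJ (n - 2) (α.fderivCompContinuousLinearMap (.id ℝ E) L) := by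
  intro θ
  -- An antilinear `L` satisfies `L (e^{iθ} v) = e^{iθ} (e^{-2iθ} L v)`, whence the drop of the
  -- weight by 2.
  rw [fderivComp_id_comp α (L' := Complex.exp (-2 * (θ * Complex.I)) • L), hα θ, smul_fderivComp,
    hα.isComplexMultilinear.fderivComp_smul, smul_smul, ← Complex.exp_add]
  · push_cast
    congr 2
    ring
  · ext v
    simp only [ContinuousLinearMap.comp_apply, rot_stdJ_apply, _root_.smul_apply, smul_smul,
      ← Complex.exp_add]
    rw [map_exp_smul_of_antilinear hL]
    congr 2
    ring

/-- The derivation of forms induced by the endomorphism `L`, as a continuous linear map. -/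
def derivationCLM {n : ℕ} (L : E →L[ℝ] E) : (E [⋀^Fin n]→L[ℝ] ℂ) →L[ℝ] E [⋀^Fin n]→L[ℝ] ℂ :=
  (fderivCompContinuousLinearMapCLM ℂ (.id ℝ E)).flip L

theorem derivationCLM_apply {n : ℕ} (L : E →L[ℝ] E) (α : E [⋀^Fin n]→L[ℝ] ℂ) :
    derivationCLM L α = α.fderivCompContinuousLinearMap (.id ℝ E) L := rfl

/-- The alternatization intertwines the derivations. -/
theorem fderivComp_alternatizeUncurryFin {n : ℕ} (g : E →L[ℝ] E [⋀^Fin n]→L[ℝ] ℂ)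
    (L : E →L[ℝ] E) :
    (alternatizeUncurryFin g).fderivCompContinuousLinearMap (.id ℝ E) L =
      alternatizeUncurryFin (g ∘L L) + alternatizeUncurryFin (derivationCLM L ∘L g) := by
  ext v
  rw [fderivComp_id_apply, ContinuousAlternatingMap.add_apply]
  simp only [alternatizeUncurryFin_apply]
  rw [Finset.sum_comm, ← Finset.sum_add_distrib]
  refine Finset.sum_congr rfl fun j _ => ?_
  -- `L` acts either on the direction slot `j`, giving `g ∘L L`, or on one of the other slots,
  -- giving the derivation of the value of `g`.
  rw [Fin.sum_univ_succAbove _ j, ← Finset.smul_sum, ← smul_add]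
  have h1 : j.removeNth (Function.update v j (L (v j))) = j.removeNth v := by
    ext i; simp [Fin.removeNth]
  have h2 : ∀ i : Fin n, j.removeNth (Function.update v (j.succAbove i) (L (v (j.succAbove i)))) =
      Function.update (j.removeNth v) i (L (v (j.succAbove i))) := by
    intro i
    ext l
    by_cases h : l = i
    · subst h; simp [Fin.removeNth]
    · simp [Fin.removeNth, h]
  have h3 : ∀ i : Fin n, Function.update v (j.succAbove i) (L (v (j.succAbove i))) j = v j :=
    fun i => Function.update_of_ne (Fin.ne_succAbove j i) _ _
  simp only [h1, h2, h3, Function.update_self, ContinuousLinearMap.comp_apply,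
    derivationCLM_apply, fderivComp_id_apply]
  exact smul_add _ _ _

/-! #### The obstruction to holomorphy at a point

Here `α` is the value of an `(n, 0)`-form, `W` its derivative, `φ` the value of a Beltrami
differential and `F` its derivative. -/

/-- The antilinear family of `(n, 0)`-forms
`v ↦ ∂̄_v α - ∂_{φ v} α - ∑ α(…, (∂_• φ) v, …)`, whose alternatization is `∂̄α + ∂(φ ⌟ α)`. -/
def obstruction {n : ℕ} (α : E [⋀^Fin n]→L[ℝ] ℂ) (W : E →L[ℝ] E [⋀^Fin n]→L[ℝ] ℂ)
    (φ : E →L[ℝ] E) (F : E →L[ℝ] E →L[ℝ] E) : E →L[ℝ] E [⋀^Fin n]→L[ℝ] ℂ :=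
  antiPart W - linPart W ∘L φ -
    α.fderivCompContinuousLinearMap (.id ℝ E) ∘L (linPart F).flip

theorem linPart_clm_apply (F : E →L[ℝ] E →L[ℝ] E) (v w : E) :
    linPart F v w = (1 / 2 : ℂ) • (F v w - Complex.I • F (Complex.I • v) w) := rfl

theorem linPart_flip_I_smul {F : E →L[ℝ] E →L[ℝ] E}
    (hF : ∀ u v, F u (Complex.I • v) = -(Complex.I • F u v)) (v : E) :
    (linPart F).flip (Complex.I • v) = -(Complex.I • (linPart F).flip v) := by
  ext u
  change linPart F u (Complex.I • v) = -(Complex.I • linPart F u v)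
  rw [linPart_clm_apply, linPart_clm_apply, hF, hF, smul_comm Complex.I (1 / 2 : ℂ)]
  module

theorem linPart_flip_apply_I_smul (F : E →L[ℝ] E →L[ℝ] E) (v u : E) :
    (linPart F).flip v (Complex.I • u) = Complex.I • (linPart F).flip v u := by
  change linPart F (Complex.I • u) v = Complex.I • linPart F u v
  rw [linPart_I_smul]
  rfl

section

variable {n : ℕ} {α : E [⋀^Fin n]→L[ℝ] ℂ} {W : E →L[ℝ] E [⋀^Fin n]→L[ℝ] ℂ}
  {φ : E →L[ℝ] E} {F : E →L[ℝ] E →L[ℝ] E}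

theorem obstruction_I_smul (hα : HasWeight stdJ n α)
    (hφ : ∀ v, φ (Complex.I • v) = -(Complex.I • φ v))
    (hF : ∀ u v, F u (Complex.I • v) = -(Complex.I • F u v)) (v : E) :
    obstruction α W φ F (Complex.I • v) = -(Complex.I • obstruction α W φ F v) := by
  simp only [obstruction, _root_.sub_apply, ContinuousLinearMap.comp_apply]
  rw [antiPart_I_smul, hφ, _root_.map_neg, linPart_I_smul, linPart_flip_I_smul hF,
    _root_.map_neg, hα.isComplexMultilinear.fderivComp_smul]
  module

theorem hasWeight_obstruction (hα : HasWeight stdJ n α) (hW : ∀ v, HasWeight stdJ n (W v))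
    (v : E) : HasWeight stdJ n (obstruction α W φ F v) :=
  ((HasWeight.antiPart hW v).sub (HasWeight.linPart hW _)).sub
    (hα.fderivComp_linear (linPart_flip_apply_I_smul F v))

/-- The derivative of the contraction of a form. -/
def contractDeriv {n : ℕ} (α : E [⋀^Fin n]→L[ℝ] ℂ) (W : E →L[ℝ] E [⋀^Fin n]→L[ℝ] ℂ)
    (φ : E →L[ℝ] E) (F : E →L[ℝ] E →L[ℝ] E) : E →L[ℝ] E [⋀^Fin n]→L[ℝ] ℂ :=
  derivationCLM φ ∘L W +
    α.fderivCompContinuousLinearMap (.id ℝ E) ∘L F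

theorem contractDeriv_apply (v : E) : contractDeriv α W φ F v =
    (W v).fderivCompContinuousLinearMap (.id ℝ E) φ +
      α.fderivCompContinuousLinearMap (.id ℝ E) (F v) := rfl

theorem hasWeight_contractDeriv (hα : HasWeight stdJ n α) (hW : ∀ v, HasWeight stdJ n (W v))
    (hφ : ∀ v, φ (Complex.I • v) = -(Complex.I • φ v))
    (hF : ∀ u v, F u (Complex.I • v) = -(Complex.I • F u v)) (v : E) :
    HasWeight stdJ (n - 2) (contractDeriv α W φ F v) :=
  ((hW v).fderivComp_antilinear hφ).add (hα.fderivComp_antilinear (hF v))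

theorem linPart_contractDeriv (hα : IsComplexMultilinear α) :
    linPart (contractDeriv α W φ F) =
      derivationCLM φ ∘L linPart W +
        α.fderivCompContinuousLinearMap (.id ℝ E) ∘L linPart F := by
  ext1 v
  rw [linPart_apply, contractDeriv_apply, contractDeriv_apply]
  simp only [_root_.add_apply, ContinuousLinearMap.comp_apply, derivationCLM_apply]
  have h1 : (linPart W v).fderivCompContinuousLinearMap (.id ℝ E) φ =
      (1 / 2 : ℂ) • ((W v).fderivCompContinuousLinearMap (.id ℝ E) φ -
        Complex.I • (W (Complex.I • v)).fderivCompContinuousLinearMap (.id ℝ E) φ) := by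
    rw [linPart_apply, smul_fderivComp, ← smul_fderivComp _ Complex.I]
    congr 1
    exact map_sub (derivationCLM φ) _ _
  rw [h1, linPart_apply F, hα.fderivComp_smul, _root_.map_sub, hα.fderivComp_smul]
  module

theorem alternatizeUncurryFin_sub {k : ℕ} (g h : E →L[ℝ] E [⋀^Fin k]→L[ℝ] ℂ) :
    alternatizeUncurryFin (g - h) = alternatizeUncurryFin g - alternatizeUncurryFin h :=
  _root_.map_sub (alternatizeUncurryFinCLM ℝ E ℂ) g h

/-- `∂̄α + ∂(φ ⌟ α)` is the alternatization of the obstruction. -/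
theorem alternatize_antiPart_add_alternatize_linPart_contractDeriv
    (hα : IsComplexMultilinear α) (hW : alternatizeUncurryFin (linPart W) = 0) :
    alternatizeUncurryFin (antiPart W) + alternatizeUncurryFin (linPart (contractDeriv α W φ F)) =
      alternatizeUncurryFin (obstruction α W φ F) := by
  -- Deriving `∂α = 0` along `φ` trades the `derivationCLM φ` term for `-linPart W ∘L φ`.
  have h := fderivComp_alternatizeUncurryFin (linPart W) φ
  rw [hW] at h
  have h0 : (0 : E [⋀^Fin (n + 1)]→L[ℝ] ℂ).fderivCompContinuousLinearMap (.id ℝ E) φ = 0 :=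
    _root_.map_zero (derivationCLM φ)
  rw [h0] at h
  rw [linPart_contractDeriv hα, alternatizeUncurryFin_add, obstruction, alternatizeUncurryFin_sub,
    alternatizeUncurryFin_sub, alternatizeUncurryFin_fderivComp_swap α _ (linPart F),
    eq_neg_of_add_eq_zero_right h.symm]
  abel

/-- The exterior derivative of the pullback of `α` under `1 + φ`. -/
theorem alternatize_pullback_deriv (hW : alternatizeUncurryFin (linPart W) = 0)
    (hint : ∀ u v, (antiPart F u - linPart F (φ u)) v = (antiPart F v - linPart F (φ v)) u) :
    alternatizeUncurryFin (compContinuousLinearMapCLM (.id ℝ E + φ) ∘L W +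
        α.fderivCompContinuousLinearMap (.id ℝ E + φ) ∘L F) =
      alternatizeUncurryFin
        (compContinuousLinearMapCLM (.id ℝ E + φ) ∘L obstruction α W φ F) := by
  set A : E →L[ℝ] E := .id ℝ E + φ with hA
  -- The argument `φ v` is written as `A v - v`, so that the `linPart W ∘L A` term becomes a genuine
  -- pullback of `∂α`.
  have hWd : W = antiPart W - linPart W ∘L φ + linPart W ∘L A := by
    conv_lhs => rw [← linPart_add_antiPart W]
    rw [hA, ContinuousLinearMap.comp_add, ContinuousLinearMap.comp_id]
    abel
  have hFd : F = antiPart F - linPart F ∘L φ + linPart F ∘L A := by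
    conv_lhs => rw [← linPart_add_antiPart F]
    rw [hA, ContinuousLinearMap.comp_add, ContinuousLinearMap.comp_id]
    abel
  have h1 : alternatizeUncurryFin
      (compContinuousLinearMapCLM A ∘L linPart W ∘L A) = 0 := by
    rw [← alternatizeUncurryFin_compContinuousLinearMap, hW]
    rfl
  -- The only use of integrability: the bilinear map is symmetric.
  have h2 : alternatizeUncurryFin (α.fderivCompContinuousLinearMap A ∘L
      (antiPart F - linPart F ∘L φ)) = 0 :=
    alternatizeUncurryFin_fderivCompContinuousLinearMap_eq_zero α A hint
  have h3 : α.fderivCompContinuousLinearMap A ∘L (linPart F ∘L A).flip =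
      compContinuousLinearMapCLM A ∘L
        α.fderivCompContinuousLinearMap (.id ℝ E) ∘L (linPart F).flip := by
    ext1 v
    exact fderivComp_comp α A ((linPart F).flip v)
  have h4 : alternatizeUncurryFin (compContinuousLinearMapCLM A ∘L W) = alternatizeUncurryFin
      (compContinuousLinearMapCLM A ∘L (antiPart W - linPart W ∘L φ)) := by
    conv_lhs => rw [hWd]
    rw [ContinuousLinearMap.comp_add, alternatizeUncurryFin_add, h1, add_zero]
  have h5 : alternatizeUncurryFin (α.fderivCompContinuousLinearMap A ∘L F) =
      alternatizeUncurryFin (α.fderivCompContinuousLinearMap A ∘L linPart F ∘L A) := by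
    conv_lhs => rw [hFd]
    rw [ContinuousLinearMap.comp_add, alternatizeUncurryFin_add, h2, zero_add]
  rw [alternatizeUncurryFin_add, h4, h5, alternatizeUncurryFin_fderivComp_swap, h3, obstruction,
    ContinuousLinearMap.comp_sub _ (antiPart W - linPart W ∘L φ), alternatizeUncurryFin_sub,
    ← sub_eq_add_neg]

end

/-! ### Vanishing and type of the pulled-back alternatization -/

section

variable {n : ℕ} {φ : E →L[ℝ] E} {G : E →L[ℝ] E [⋀^Fin n]→L[ℝ] ℂ}

/-- Take `G' = G ∘ (1 + φ)⁻¹`. The second clause lets `G'` inherit the weights of the values of `G`.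
-/
theorem Nondegenerate.exists_factor (hφ : Nondegenerate φ) (G : E →L[ℝ] E [⋀^Fin n]→L[ℝ] ℂ) :
    ∃ G' : E →L[ℝ] E [⋀^Fin n]→L[ℝ] ℂ, G = G' ∘L (.id ℝ E + φ) ∧ ∀ v, ∃ u, G' v = G u := by
  obtain ⟨e, he⟩ := hφ
  rw [← he]
  refine ⟨G ∘L (e.symm : E →L[ℝ] E), ?_, fun v => ⟨e.symm v, rfl⟩⟩
  ext1 v
  simp

theorem HasWeight.comp {k : ℕ} {w : ℤ} {α : E [⋀^Fin k]→L[ℝ] ℂ} {J J' C : E →L[ℝ] E}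
    (hα : HasWeight J w α) (hC : C ∘L J' = J ∘L C) :
    HasWeight J' w (α.compContinuousLinearMap C) := by
  intro θ
  rw [← smul_compContinuousLinearMap, ← hα θ]
  ext v
  simp only [compContinuousLinearMap_apply]
  congr 1
  ext i
  have := DFunLike.congr_fun hC (v i)
  simp only [ContinuousLinearMap.comp_apply] at this
  simp only [Function.comp_apply, rot_apply, _root_.map_add, _root_.map_smul, this]

theorem alternatize_pullback_eq_antiPart [FiniteDimensional ℂ E] (hn : Module.finrank ℂ E = n)
    {G' : E →L[ℝ] E [⋀^Fin n]→L[ℝ] ℂ} (hG' : ∀ v, HasWeight stdJ n (G' v)) :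
    alternatizeUncurryFin (compContinuousLinearMapCLM (.id ℝ E + φ) ∘L G' ∘L (.id ℝ E + φ)) =
      (alternatizeUncurryFin (antiPart G')).compContinuousLinearMap (.id ℝ E + φ) := by
  rw [← alternatizeUncurryFin_compContinuousLinearMap,
    alternatizeUncurryFin_eq_linPart_add_antiPart G',
    alternatizeUncurryFin_linPart_eq_zero hn hG', zero_add]

/-- The form is the pullback by `1 + φ` of the alternatization of `G'`, whose `(n + 1, 0)`-part
vanishes for dimension reasons. -/
theorem hasWeight_alternatize_pullback [FiniteDimensional ℂ E] (hn : Module.finrank ℂ E = n)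
    (hnd : Nondegenerate φ) (hG : ∀ v, HasWeight stdJ n (G v)) :
    HasWeight (inducedJ φ) (n - 1)
      (alternatizeUncurryFin (compContinuousLinearMapCLM (.id ℝ E + φ) ∘L G)) := by
  obtain ⟨G', rfl, h⟩ := hnd.exists_factor G
  have hG' : ∀ v, HasWeight stdJ n (G' v) := fun v => by
    obtain ⟨u, hu⟩ := h v
    rw [hu]
    exact hG u
  rw [alternatize_pullback_eq_antiPart hn hG']
  exact (hasWeight_alternatizeUncurryFin_antilinear (antiPart_I_smul G')
    (HasWeight.antiPart hG')).comp (one_add_comp_inducedJ hnd)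

/-- The pulled back antilinear family has vanishing alternatization only if it vanishes. -/
theorem eq_zero_of_alternatize_pullback_eq_zero [FiniteDimensional ℂ E]
    (hn : Module.finrank ℂ E = n) (hnd : Nondegenerate φ)
    (hφ : ∀ v, φ (Complex.I • v) = -(Complex.I • φ v)) (hG : ∀ v, HasWeight stdJ n (G v))
    (hGa : ∀ v, G (Complex.I • v) = -(Complex.I • G v))
    (h0 : alternatizeUncurryFin (compContinuousLinearMapCLM (.id ℝ E + φ) ∘L G) = 0) :
    G = 0 := by
  obtain ⟨G', rfl, h⟩ := hnd.exists_factor G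
  have hG' : ∀ v, HasWeight stdJ n (G' v) := fun v => by
    obtain ⟨u, hu⟩ := h v
    rw [hu]
    exact hG u
  rw [alternatize_pullback_eq_antiPart hn hG'] at h0
  have h1 : alternatizeUncurryFin (antiPart G') = 0 := by
    obtain ⟨e, he⟩ := hnd
    rw [← he] at h0
    ext v
    have := DFunLike.congr_fun h0 (fun i => e.symm (v i))
    simpa [Function.comp_def] using this
  have h2 : antiPart G' = 0 := eq_zero_of_alternatizeUncurryFin_eq_zero (antiPart_I_smul G')
    (fun v => (HasWeight.antiPart hG' v).isComplexMultilinear) h1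
  have h3 : ∀ v, G' (Complex.I • v) = Complex.I • G' v := by
    have := linPart_add_antiPart G'
    rw [h2, add_zero] at this
    rw [← this]
    exact linPart_I_smul G'
  -- `G v = G' v + G' (φ v)` is a sum of a complex-linear and an antilinear term. As `G` is
  -- antilinear, the first is zero.
  have h4 : ∀ v, G' v = 0 := by
    intro v
    have := hGa v
    simp only [ContinuousLinearMap.comp_apply, _root_.add_apply, ContinuousLinearMap.id_apply,
      _root_.map_add, hφ, _root_.map_neg, h3] at this
    have h5 : (2 * Complex.I) • G' v = 0 := by
      rw [eq_neg_iff_add_eq_zero] at this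
      rw [← this]
      module
    exact (smul_eq_zero.1 h5).resolve_left (by simp)
  ext1 v
  exact h4 _

end

/-- The pulled back form is `∂̄`-closed exactly if `∂̄α + ∂(φ ⌟ α)` vanishes. -/
theorem alternatize_pullback_eq_zero_iff [FiniteDimensional ℂ E] {n : ℕ}
    (hn : Module.finrank ℂ E = n) {φ : E →L[ℝ] E} {G : E →L[ℝ] E [⋀^Fin n]→L[ℝ] ℂ}
    (hnd : Nondegenerate φ)
    (hφ : ∀ v, φ (Complex.I • v) = -(Complex.I • φ v)) (hG : ∀ v, HasWeight stdJ n (G v))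
    (hGa : ∀ v, G (Complex.I • v) = -(Complex.I • G v)) :
    alternatizeUncurryFin (compContinuousLinearMapCLM (.id ℝ E + φ) ∘L G) = 0 ↔
      alternatizeUncurryFin G = 0 := by
  constructor
  · intro h
    rw [eq_zero_of_alternatize_pullback_eq_zero hn hnd hφ hG hGa h]
    exact _root_.map_zero (alternatizeUncurryFinCLM ℝ E ℂ)
  · intro h
    rw [eq_zero_of_alternatizeUncurryFin_eq_zero hGa (fun v => (hG v).isComplexMultilinear) h,
      ContinuousLinearMap.comp_zero]
    exact _root_.map_zero (alternatizeUncurryFinCLM ℝ E ℂ)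

/-! #### The exponential of the contraction is a pullback -/

theorem IsComplexMultilinear.contract_eq {φ : E →L[ℝ] E} {k : ℕ} {α : E [⋀^Fin k]→L[ℝ] ℂ}
    (hα : IsComplexMultilinear α) : contract φ α = derivationCLM φ α := by
  cases k with
  | zero =>
    rw [derivationCLM_apply, fderivCompContinuousLinearMap_of_isEmpty]
    rfl
  | succ k =>
    rw [derivationCLM_apply, fderivCompContinuousLinearMap_eq_alternatizeUncurryFin]
    change alternatizeUncurryFin _ = alternatizeUncurryFin _
    congr 1
    ext v u
    change (1 / 2 : ℂ) * (α (Matrix.vecCons (φ v) u) -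
      Complex.I * α (Matrix.vecCons (Complex.I • φ v) u)) = α (Matrix.vecCons (φ v) u)
    rw [hα.map_cons]
    linear_combination (-(1 / 2) * α (Matrix.vecCons (φ v) u)) * Complex.I_mul_I

/-- A slotwise formula free of complex multilinearity, since contractions of an `(n, 0)`-form lose
that property and must be contracted again. -/
theorem contract_apply (φ : E →L[ℝ] E) {k : ℕ} (α : E [⋀^Fin k]→L[ℝ] ℂ) (v : Fin k → E) :
    contract φ α v = ∑ i, (1 / 2 : ℂ) * (α (Function.update v i (φ (v i))) -
      Complex.I * α (Function.update v i (Complex.I • φ (v i)))) := by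
  cases k with
  | zero => simp [contract]
  | succ k =>
    rw [contract, alternatizeUncurryFin_apply]
    refine Finset.sum_congr rfl fun i _ => ?_
    change (-1) ^ (i : ℕ) • ((1 / 2 : ℂ) * (α (Matrix.vecCons (φ (v i)) (i.removeNth v)) -
      Complex.I * α (Matrix.vecCons (Complex.I • φ (v i)) (i.removeNth v)))) = _
    have h : ∀ x, α (Function.update v i x) =
        (-1) ^ (i : ℕ) • α (Matrix.vecCons x (i.removeNth v)) := by
      intro x
      rw [← map_insertNth, Fin.insertNth_removeNth]
    rw [h, h]
    simp only [zsmul_eq_mul]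
    ring

/-- Double counting: each `T` of size `j + 1` is `insert i S` once for each `i ∈ T`. -/
theorem sum_powersetCard_insert {ι M : Type*} [Fintype ι] [DecidableEq ι] [AddCommMonoid M]
    (f : Finset ι → M) (j : ℕ) :
    ∑ i : ι, ∑ S ∈ Finset.powersetCard j Finset.univ, (if i ∈ S then 0 else f (insert i S)) =
      (j + 1) • ∑ T ∈ Finset.powersetCard (j + 1) (Finset.univ : Finset ι), f T := by
  have h1 : (j + 1) • ∑ T ∈ Finset.powersetCard (j + 1) (Finset.univ : Finset ι), f T =
      ∑ T ∈ Finset.powersetCard (j + 1) (Finset.univ : Finset ι), ∑ _i ∈ T, f T := by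
    rw [Finset.smul_sum]
    refine Finset.sum_congr rfl fun T hT => ?_
    rw [Finset.sum_const, (Finset.mem_powersetCard.1 hT).2]
  have h2 : ∀ i : ι, ∑ S ∈ Finset.powersetCard j Finset.univ,
      (if i ∈ S then 0 else f (insert i S)) =
      ∑ S ∈ (Finset.powersetCard j Finset.univ).filter (fun S => i ∉ S), f (insert i S) := by
    intro i
    rw [Finset.sum_filter]
    exact Finset.sum_congr rfl fun S _ => by by_cases h : i ∈ S <;> simp [h]
  simp_rw [h2]
  rw [h1, Finset.sum_sigma', Finset.sum_sigma']
  refine Finset.sum_bij' (fun x _ => ⟨insert x.1 x.2, x.1⟩) (fun x _ => ⟨x.2, x.1.erase x.2⟩)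
    ?_ ?_ ?_ ?_ ?_
  · rintro ⟨i, S⟩ h
    simp only [Finset.mem_sigma, Finset.mem_filter, Finset.mem_powersetCard] at h
    simp [h.2.2, h.2.1.2]
  · rintro ⟨T, i⟩ h
    simp only [Finset.mem_sigma, Finset.mem_powersetCard] at h
    simp [Finset.card_erase_of_mem h.2, h.1.2]
  · rintro ⟨i, S⟩ h
    simp only [Finset.mem_sigma, Finset.mem_filter] at h
    simp [h.2.2]
  · rintro ⟨T, i⟩ h
    simp only [Finset.mem_sigma] at h
    simp [Finset.insert_erase h.2]
  · rintro ⟨i, S⟩ h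
    rfl

/-- Contraction only sees slots in which the form is complex-linear. A slot already filled by the
antilinear `φ` gives zero, so `j` contractions fill `j` distinct slots, in `j!` orders. -/
theorem contract_iterate_apply {φ : E →L[ℝ] E} (hφ : ∀ v, φ (Complex.I • v) = -(Complex.I • φ v))
    {k : ℕ} {α : E [⋀^Fin k]→L[ℝ] ℂ} (hα : IsComplexMultilinear α) (j : ℕ) (v : Fin k → E) :
    (contract φ)^[j] α v = (j.factorial : ℂ) *
      ∑ S ∈ Finset.powersetCard j Finset.univ, α (S.piecewise (fun i => φ (v i)) v) := by
  induction j generalizing v with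
  | zero => simp
  | succ j ih =>
    rw [Function.iterate_succ_apply', contract_apply]
    have hin : ∀ (S : Finset (Fin k)) (i : Fin k) (x : E), i ∈ S →
        S.piecewise (fun l => φ (Function.update v i x l)) (Function.update v i x) =
          Function.update (S.piecewise (fun l => φ (v l)) v) i (φ x) := by
      intro S i x hi
      ext l
      by_cases hl : l = i
      · subst hl; simp [hi]
      · by_cases hS : l ∈ S <;> simp [hl, hS]
    have hout : ∀ (S : Finset (Fin k)) (i : Fin k) (x : E), i ∉ S →
        S.piecewise (fun l => φ (Function.update v i x l)) (Function.update v i x) =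
          Function.update (S.piecewise (fun l => φ (v l)) v) i x := by
      intro S i x hi
      ext l
      by_cases hl : l = i
      · subst hl; simp [hi]
      · by_cases hS : l ∈ S <;> simp [hl, hS]
    have hneg : ∀ (u : Fin k → E) (i : Fin k) (x : E),
        α (Function.update u i (-x)) = -α (Function.update u i x) :=
      α.toMultilinearMap.map_update_neg
    have hterm : ∀ (i : Fin k) (S : Finset (Fin k)),
        (1 / 2 : ℂ) * (α (S.piecewise (fun l => φ (Function.update v i (φ (v i)) l))
            (Function.update v i (φ (v i)))) -
          Complex.I * α (S.piecewise (fun l => φ (Function.update v i (Complex.I • φ (v i)) l))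
            (Function.update v i (Complex.I • φ (v i))))) =
        if i ∈ S then 0 else α ((insert i S).piecewise (fun l => φ (v l)) v) := by
      intro i S
      by_cases hi : i ∈ S
      · rw [if_pos hi, hin S i _ hi, hin S i _ hi, hφ, hneg, hα]
        linear_combination (1 / 2 * α (Function.update (S.piecewise (fun l => φ (v l)) v) i
          (φ (φ (v i))))) * Complex.I_mul_I
      · rw [if_neg hi, hout S i _ hi, hout S i _ hi, hα, Finset.piecewise_insert]
        linear_combination (-(1 / 2) * α (Function.update (S.piecewise (fun l => φ (v l)) v) i
          (φ (v i)))) * Complex.I_mul_I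
    simp_rw [ih]
    have h := sum_powersetCard_insert (fun T => α (T.piecewise (fun l => φ (v l)) v)) j
    simp_rw [← hterm, ← Finset.mul_sum, Finset.sum_sub_distrib, ← Finset.mul_sum] at h
    rw [nsmul_eq_mul] at h
    rw [Nat.factorial_succ, Nat.cast_mul, mul_comm ((j + 1 : ℕ) : ℂ), mul_assoc, ← h,
      ← Finset.mul_sum, Finset.sum_sub_distrib, ← Finset.mul_sum, ← Finset.mul_sum,
      ← Finset.mul_sum]
    ring

/-- The factorials cancel, leaving the multilinear expansion of `α` at the vectors `φ (v i) + v i`.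
-/
theorem IsComplexMultilinear.expContract_eq {φ : E →L[ℝ] E}
    (hφ : ∀ v, φ (Complex.I • v) = -(Complex.I • φ v)) {k : ℕ} {α : E [⋀^Fin k]→L[ℝ] ℂ}
    (hα : IsComplexMultilinear α) :
    expContract φ α = α.compContinuousLinearMap (.id ℝ E + φ) := by
  ext v
  rw [expContract, compContinuousLinearMap_apply, ContinuousAlternatingMap.sum_apply]
  have h1 : (⇑(ContinuousLinearMap.id ℝ E + φ) ∘ v) = (fun i => φ (v i)) + v := by
    ext i; simp [add_comm]
  have h2 := α.toMultilinearMap.map_add_univ (fun i => φ (v i)) v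
  rw [h1]
  change _ = α.toMultilinearMap _
  rw [h2, ← Finset.powerset_univ, Finset.sum_powerset, Finset.card_univ, Fintype.card_fin]
  refine Finset.sum_congr rfl fun j _ => ?_
  rw [ContinuousAlternatingMap.smul_apply, contract_iterate_apply hφ hα, Complex.real_smul,
    ← mul_assoc]
  push_cast
  rw [inv_mul_cancel₀ (Nat.cast_ne_zero.2 j.factorial_ne_zero), one_mul]
  rfl

/-! #### Smoothness of the pullback -/

theorem contDiff_comp_comp {X V V' : Type*} [NormedAddCommGroup X] [NormedSpace ℝ X]
    [NormedAddCommGroup V] [NormedSpace ℝ V] [NormedAddCommGroup V'] [NormedSpace ℝ V']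
    {m : WithTop ℕ∞} (C : V' →L[ℝ] X →L[ℝ] V) (D : (X →L[ℝ] V) →L[ℝ] V')
    {P : (X →L[ℝ] X) → V →L[ℝ] V} (hP : ContDiff ℝ m P) :
    ContDiff ℝ m (fun A : X →L[ℝ] X => D ∘L ContinuousLinearMap.compL ℝ X V V (P A) ∘L
      (ContinuousLinearMap.compL ℝ X X V).flip A ∘L C) := by
  have h3 : ContDiff ℝ m (fun Q => ContinuousLinearMap.compL ℝ X V V Q) := by fun_prop
  have h4 : ContDiff ℝ m (fun A => ContinuousLinearMap.compL ℝ X V V (P A)) := h3.comp hP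
  exact contDiff_const.clm_comp (h4.clm_comp
    ((ContinuousLinearMap.contDiff (E := X →L[ℝ] X) (F := (X →L[ℝ] V) →L[ℝ] X →L[ℝ] V)
      (ContinuousLinearMap.compL ℝ X X V).flip).clm_comp contDiff_const))

theorem contDiff_compContinuousLinearMapCLM (k : ℕ) {m : WithTop ℕ∞} :
    ContDiff ℝ m (fun A : E →L[ℝ] E =>
      (compContinuousLinearMapCLM A : (E [⋀^Fin k]→L[ℝ] ℂ) →L[ℝ] E [⋀^Fin k]→L[ℝ] ℂ)) := by
  induction k with
  | zero =>
    have : (fun A : E →L[ℝ] E =>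
        (compContinuousLinearMapCLM A : (E [⋀^Fin 0]→L[ℝ] ℂ) →L[ℝ] E [⋀^Fin 0]→L[ℝ] ℂ)) =
        fun _ => .id ℝ _ := by
      ext A α v
      exact congrArg α (Subsingleton.elim _ _)
    rw [this]
    exact contDiff_const
  | succ k ih =>
    let C : (E [⋀^Fin (k + 1)]→L[ℝ] ℂ) →L[ℝ] E →L[ℝ] E [⋀^Fin k]→L[ℝ] ℂ :=
      (curryLeftLI (𝕜 := ℝ) (E := E) (F := ℂ) (n := k)).toContinuousLinearMap
    let c := ContinuousLinearMap.compL ℝ E (E [⋀^Fin k]→L[ℝ] ℂ) (E [⋀^Fin k]→L[ℝ] ℂ)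
    let d := ContinuousLinearMap.compL ℝ E E (E [⋀^Fin k]→L[ℝ] ℂ)
    -- Alternatizing the curried form multiplies it by `k + 1`; this expresses the pullback in
    -- degree `k + 1` through the one in degree `k`.
    have h : (fun A : E →L[ℝ] E => (compContinuousLinearMapCLM A :
          (E [⋀^Fin (k + 1)]→L[ℝ] ℂ) →L[ℝ] E [⋀^Fin (k + 1)]→L[ℝ] ℂ)) =
        fun A => ((k + 1 : ℝ)⁻¹) • (alternatizeUncurryFinCLM ℝ E ℂ ∘L
          c (compContinuousLinearMapCLM A) ∘L d.flip A ∘L C) := by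
      ext1 A
      ext1 α
      have h2 := alternatizeUncurryFin_curryLeft (α.compContinuousLinearMap A)
      have h3 : curryLeft (α.compContinuousLinearMap A) =
          compContinuousLinearMapCLM A ∘L α.curryLeft ∘L A := by
        ext1 x
        rw [curryLeft_compContinuousLinearMap]
        rfl
      rw [h3] at h2
      change _ = ((k + 1 : ℝ)⁻¹) •
        alternatizeUncurryFin (compContinuousLinearMapCLM A ∘L α.curryLeft ∘L A)
      rw [h2, ← Nat.cast_smul_eq_nsmul ℝ, smul_smul]
      push_cast
      rw [inv_mul_cancel₀ (by positivity), one_smul]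
      rfl
    rw [h]
    exact (contDiff_comp_comp C (alternatizeUncurryFinCLM ℝ E ℂ) ih).const_smul _

theorem contDiffOn_pullback {k : ℕ} {m : WithTop ℕ∞} {α : E → E [⋀^Fin k]→L[ℝ] ℂ}
    {A : E → E →L[ℝ] E} {s : Set E} (hα : ContDiffOn ℝ m α s) (hA : ContDiffOn ℝ m A s) :
    ContDiffOn ℝ m (fun y => (α y).compContinuousLinearMap (A y)) s :=
  ((contDiff_compContinuousLinearMapCLM k).comp_contDiffOn hA).clm_apply hα

end Pointwise

/-! ### Derivatives of fields of forms on the model space -/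

section Calculus

variable {E : Type*} [NormedAddCommGroup E] [NormedSpace ℂ E]

theorem hasFDerivAt_clm_comp {V V' : Type*} [NormedAddCommGroup V] [NormedSpace ℝ V]
    [NormedAddCommGroup V'] [NormedSpace ℝ V'] (L : V →L[ℝ] V') {α : E → V} {α' : E →L[ℝ] V}
    {y : E} (h : HasFDerivAt α α' y) : HasFDerivAt (fun z => L (α z)) (L ∘L α') y :=
  L.hasFDerivAt.comp y h

theorem hasWeight_fderiv {J : E →L[ℝ] E} {w : ℤ} {k : ℕ} {α : E → E [⋀^Fin k]→L[ℝ] ℂ} {y : E}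
    (hd : DifferentiableAt ℝ α y) (hα : ∀ᶠ z in 𝓝 y, HasWeight J w (α z)) (v : E) :
    HasWeight J w (fderiv ℝ α y v) := by
  intro θ
  have h1 : HasFDerivAt (fun z => (α z).compContinuousLinearMap (rot J θ))
      (compContinuousLinearMapCLM (rot J θ) ∘L fderiv ℝ α y) y :=
    hasFDerivAt_clm_comp (compContinuousLinearMapCLM (rot J θ)) hd.hasFDerivAt
  have h2 := hd.hasFDerivAt.const_smul (Complex.exp ((w : ℂ) * θ * Complex.I))
  have h3 := h2.congr_of_eventuallyEq (hα.mono fun z hz => hz θ)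
  exact DFunLike.congr_fun (h1.unique h3) v

theorem fderiv_antilinear {f : E → E →L[ℝ] E} {y : E} (hd : DifferentiableAt ℝ f y)
    (hf : ∀ᶠ z in 𝓝 y, ∀ v, f z (Complex.I • v) = -(Complex.I • f z v)) (u v : E) :
    fderiv ℝ f y u (Complex.I • v) = -(Complex.I • fderiv ℝ f y u v) := by
  have h : ∀ w : E, HasFDerivAt (fun z => f z w) ((fderiv ℝ f y).flip w) y := fun w =>
    (ContinuousLinearMap.apply ℝ E w).hasFDerivAt.comp y hd.hasFDerivAt
  have h2 := ((h v).const_smul Complex.I).neg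
  have h3 := h2.congr_of_eventuallyEq (hf.mono fun z hz => hz v)
  exact DFunLike.congr_fun ((h _).unique h3) u

theorem fderiv_derivationCLM {n : ℕ} {α : E → E [⋀^Fin n]→L[ℝ] ℂ} {f : E → E →L[ℝ] E} {y : E}
    (hα : DifferentiableAt ℝ α y) (hf : DifferentiableAt ℝ f y) :
    fderiv ℝ (fun z => derivationCLM (f z) (α z)) y =
      contractDeriv (α y) (fderiv ℝ α y) (f y) (fderiv ℝ f y) := by
  have h1 : HasFDerivAt (fun z => fderivCompContinuousLinearMapCLM ℂ (.id ℝ E) (α z))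
      (fderivCompContinuousLinearMapCLM ℂ (.id ℝ E) ∘L fderiv ℝ α y) y :=
    hasFDerivAt_clm_comp (V' := (E →L[ℝ] E) →L[ℝ] E [⋀^Fin n]→L[ℝ] ℂ)
      (fderivCompContinuousLinearMapCLM (ι := Fin n) (𝕜 := ℝ) ℂ (.id ℝ E)) hα.hasFDerivAt
  refine (h1.clm_apply hf.hasFDerivAt).fderiv.trans ?_
  ext1 v
  rw [contractDeriv_apply, add_comm]
  rfl

theorem extDeriv_pullback_one_add {n : ℕ} {α : E → E [⋀^Fin n]→L[ℝ] ℂ} {f : E → E →L[ℝ] E}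
    {y : E} (hα : DifferentiableAt ℝ α y) (hf : DifferentiableAt ℝ f y) :
    extDeriv (fun z => (α z).compContinuousLinearMap (.id ℝ E + f z)) y =
      alternatizeUncurryFin (compContinuousLinearMapCLM (.id ℝ E + f y) ∘L fderiv ℝ α y +
        (α y).fderivCompContinuousLinearMap (.id ℝ E + f y) ∘L fderiv ℝ f y) := by
  have h := fderiv_continuousAlternatingMapCompContinuousLinearMap hα
    (hf.const_add (ContinuousLinearMap.id ℝ E))
  rw [fderiv_const_add] at h
  rw [extDeriv, h]

end Calculus

section Manifold

variable {E : Type*} [NormedAddCommGroup E] [NormedSpace ℂ E]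
  {X : Type*} [TopologicalSpace X] [ChartedSpace E X] [IsManifold 𝓘(ℂ, E) ω X]

/-! #### Forms and endomorphisms in a chart -/

theorem coordChange_I_smul (x y p : X) (v : E) :
    coordChange x y p (Complex.I • v) = Complex.I • coordChange x y p v :=
  (tangentCoordChange 𝓘(ℂ, E) x y p).map_smul Complex.I v

theorem coordChange_comp_stdJ (x y p : X) :
    coordChange x y p ∘L stdJ = (stdJ : E →L[ℝ] E) ∘L coordChange x y p := by
  ext v
  exact coordChange_I_smul x y p v

theorem coordChange_self (x : X) : (coordChange x x x : E →L[ℝ] E) = .id ℝ E := by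
  ext v
  exact tangentCoordChange_self (mem_extChartAt_source x)

theorem coordChange_coordChange {x p : X} (hp : p ∈ (extChartAt 𝓘(ℂ, E) x).source) (v : E) :
    coordChange p x p (coordChange x p p v) = v := by
  refine (tangentCoordChange_comp (I := 𝓘(ℂ, E)) ⟨⟨hp, mem_extChartAt_source p⟩, hp⟩).trans ?_
  exact tangentCoordChange_self hp

theorem coordChange_coordChange' {x p : X} (hp : p ∈ (extChartAt 𝓘(ℂ, E) x).source) (v : E) :
    coordChange x p p (coordChange p x p v) = v := by
  refine (tangentCoordChange_comp (I := 𝓘(ℂ, E))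
    ⟨⟨mem_extChartAt_source p, hp⟩, mem_extChartAt_source p⟩).trans ?_
  exact tangentCoordChange_self (mem_extChartAt_source p)

theorem formInChart_self (x : X) {k : ℕ} (α : X → E [⋀^Fin k]→L[ℝ] ℂ) :
    formInChart x α (extChartAt 𝓘(ℂ, E) x x) = α x := by
  simp only [formInChart, extChartAt_to_inv, coordChange_self]
  rfl

theorem endoInChart_self (x : X) (Φ : X → E →L[ℝ] E) :
    endoInChart x Φ (extChartAt 𝓘(ℂ, E) x x) = Φ x := by
  simp only [endoInChart, extChartAt_to_inv, coordChange_self]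
  rfl

theorem hasWeight_formInChart (x : X) {k : ℕ} {w : ℤ} {α : X → E [⋀^Fin k]→L[ℝ] ℂ}
    (hα : ∀ p, HasWeight stdJ w (α p)) (y : E) : HasWeight stdJ w (formInChart x α y) :=
  (hα _).comp (coordChange_comp_stdJ _ _ _)

theorem endoInChart_antilinear (x : X) {Φ : X → E →L[ℝ] E}
    (hΦ : ∀ (x : X) (v : E), Φ x (Complex.I • v) = -(Complex.I • Φ x v)) (y v : E) :
    endoInChart x Φ y (Complex.I • v) = -(Complex.I • endoInChart x Φ y v) := by
  simp only [endoInChart, ContinuousLinearMap.comp_apply, coordChange_I_smul, hΦ, _root_.map_neg]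

/-- `endoInChart` is conjugation by the coordinate change, so contractions and pullbacks commute
with passing to the chart. -/
theorem comp_coordChange_eq {x : X} (Φ : X → E →L[ℝ] E) {y : E}
    (hy : y ∈ (extChartAt 𝓘(ℂ, E) x).target) :
    Φ ((extChartAt 𝓘(ℂ, E) x).symm y) ∘L
        coordChange x ((extChartAt 𝓘(ℂ, E) x).symm y) ((extChartAt 𝓘(ℂ, E) x).symm y) =
      coordChange x ((extChartAt 𝓘(ℂ, E) x).symm y) ((extChartAt 𝓘(ℂ, E) x).symm y) ∘L
        endoInChart x Φ y := by
  ext v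
  exact (coordChange_coordChange' ((extChartAt 𝓘(ℂ, E) x).map_target hy) _).symm

theorem formInChart_contract {x : X} {Φ : X → E →L[ℝ] E} {k : ℕ} {α : X → E [⋀^Fin k]→L[ℝ] ℂ}
    (hα : ∀ p, IsComplexMultilinear (α p)) {y : E} (hy : y ∈ (extChartAt 𝓘(ℂ, E) x).target) :
    formInChart x (fun p => contract (Φ p) (α p)) y =
      derivationCLM (endoInChart x Φ y) (formInChart x α y) := by
  simp only [formInChart, (hα _).contract_eq, derivationCLM_apply]
  exact fderivComp_id_comp _ (comp_coordChange_eq Φ hy)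

theorem formInChart_expContract {x : X} {Φ : X → E →L[ℝ] E}
    (hΦ : ∀ (x : X) (v : E), Φ x (Complex.I • v) = -(Complex.I • Φ x v)) {k : ℕ}
    {α : X → E [⋀^Fin k]→L[ℝ] ℂ} (hα : ∀ p, IsComplexMultilinear (α p)) {y : E}
    (hy : y ∈ (extChartAt 𝓘(ℂ, E) x).target) :
    formInChart x (fun p => expContract (Φ p) (α p)) y =
      (formInChart x α y).compContinuousLinearMap (.id ℝ E + endoInChart x Φ y) := by
  simp only [formInChart, (hα _).expContract_eq (hΦ _)]
  ext v
  simp only [compContinuousLinearMap_apply]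
  congr 1
  ext i
  have := DFunLike.congr_fun (comp_coordChange_eq Φ hy) (v i)
  simp only [ContinuousLinearMap.comp_apply] at this
  simp only [Function.comp_apply, _root_.add_apply, ContinuousLinearMap.id_apply, _root_.map_add,
    this]

omit [IsManifold 𝓘(ℂ, E) ω X] in
theorem chart_target_mem_nhds (x : X) :
    (extChartAt 𝓘(ℂ, E) x).target ∈ 𝓝 (extChartAt 𝓘(ℂ, E) x x) :=
  (isOpen_extChartAt_target x).mem_nhds (mem_extChartAt_target x)

omit [IsManifold 𝓘(ℂ, E) ω X] in
theorem differentiableAt_of_contDiffOn_chart {x : X} {V : Type*} [NormedAddCommGroup V]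
    [NormedSpace ℝ V] {f : E → V} (hf : ContDiffOn ℝ ∞ f (extChartAt 𝓘(ℂ, E) x).target) :
    DifferentiableAt ℝ f (extChartAt 𝓘(ℂ, E) x x) :=
  (hf.contDiffAt (chart_target_mem_nhds x)).differentiableAt (by simp)

/-! #### The operators `∂` and `∂̄` on forms of pure type -/

theorem extD_zero (x : X) {k : ℕ} : extD (fun _ : X => (0 : E [⋀^Fin k]→L[ℝ] ℂ)) x = 0 := by
  have h : formInChart x (fun _ : X => (0 : E [⋀^Fin k]→L[ℝ] ℂ)) = fun _ => 0 := rfl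
  rw [extD, h, extDeriv, fderiv_fun_const]
  exact _root_.map_zero (alternatizeUncurryFinCLM ℝ E ℂ)

theorem delbar_eq {J : X → E →L[ℝ] E} {p q k : ℕ} {α : X → E [⋀^Fin k]→L[ℝ] ℂ} (hk : p + q = k)
    (hα : ∀ y, HasWeight (J y) (p - q) (α y)) (x : X) :
    delbar J α x = typeProj (J x) p (q + 1) (extD α x) := by
  rw [delbar, Finset.sum_eq_single (p, q)]
  · simp_rw [fun y => typeProj_eq_self (hα y)]
  · rintro ⟨p', q'⟩ h hne
    rw [Finset.HasAntidiagonal.mem_antidiagonal] at h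
    have h0 : ∀ y, typeProj (J y) p' q' (α y) = 0 := fun y => typeProj_eq_zero (hα y) fun h' =>
      hne (Prod.ext (by dsimp only at h ⊢; omega) (by dsimp only at h ⊢; omega))
    simp_rw [h0, extD_zero]
    -- The zero form is given a deliberately wrong weight, off by one.
    exact typeProj_eq_zero (HasWeight.zero _ (p' - ((q' + 1 : ℕ) : ℤ) + 1)) (by simp)
  · intro h
    exact absurd (Finset.HasAntidiagonal.mem_antidiagonal.2 hk) h

theorem del_eq {J : X → E →L[ℝ] E} {p q k : ℕ} {α : X → E [⋀^Fin k]→L[ℝ] ℂ} (hk : p + q = k)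
    (hα : ∀ y, HasWeight (J y) (p - q) (α y)) (x : X) :
    del J α x = typeProj (J x) (p + 1) q (extD α x) := by
  rw [del, Finset.sum_eq_single (p, q)]
  · simp_rw [fun y => typeProj_eq_self (hα y)]
  · rintro ⟨p', q'⟩ h hne
    rw [Finset.HasAntidiagonal.mem_antidiagonal] at h
    have h0 : ∀ y, typeProj (J y) p' q' (α y) = 0 := fun y => typeProj_eq_zero (hα y) fun h' =>
      hne (Prod.ext (by dsimp only at h ⊢; omega) (by dsimp only at h ⊢; omega))
    simp_rw [h0, extD_zero]
    exact typeProj_eq_zero (HasWeight.zero _ (((p' + 1 : ℕ) : ℤ) - q' + 1)) (by simp)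
  · intro h
    exact absurd (Finset.HasAntidiagonal.mem_antidiagonal.2 hk) h

/-- The factor `½` cancels the doubling in `[Φ, Φ]`; regrouping the terms in `(u, v)` and `(v, u)`
turns the equation into a symmetry. -/
theorem IsIntegrable.symm {Φ : X → E →L[ℝ] E} (h : IsIntegrable Φ) (x : X) (u v : E) :
    (antiPart (fderiv ℝ (endoInChart x Φ) (extChartAt 𝓘(ℂ, E) x x)) u -
        linPart (fderiv ℝ (endoInChart x Φ) (extChartAt 𝓘(ℂ, E) x x)) (Φ x u)) v =
      (antiPart (fderiv ℝ (endoInChart x Φ) (extChartAt 𝓘(ℂ, E) x x)) v -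
        linPart (fderiv ℝ (endoInChart x Φ) (extChartAt 𝓘(ℂ, E) x x)) (Φ x v)) u := by
  have h1 := h x u v
  change partialBarB Φ x u v - partialB Φ x (Φ x u) v =
    partialBarB Φ x v u - partialB Φ x (Φ x v) u
  rw [delbarB, bracketB, ← two_smul ℂ, smul_smul] at h1
  norm_num at h1
  rw [sub_eq_sub_iff_add_eq_add] at h1 ⊢
  rw [h1, add_comm]

end Manifold

section Manifold

variable {E : Type*} [NormedAddCommGroup E] [NormedSpace ℂ E]
  {X : Type*} [TopologicalSpace X] [ChartedSpace E X] [IsManifold 𝓘(ℂ, E) ω X]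

/-! #### The two operators at a point -/

/-- The obstruction field of an `(n, 0)`-form and a Beltrami differential. -/
def obstructionAt {n : ℕ} (Φ : X → E →L[ℝ] E) (Ω : X → E [⋀^Fin n]→L[ℝ] ℂ) (x : X) :
    E →L[ℝ] E [⋀^Fin n]→L[ℝ] ℂ :=
  obstruction (Ω x) (fderiv ℝ (formInChart x Ω) (extChartAt 𝓘(ℂ, E) x x)) (Φ x)
    (fderiv ℝ (endoInChart x Φ) (extChartAt 𝓘(ℂ, E) x x))

variable {n : ℕ} {Φ : X → E →L[ℝ] E} {Ω : X → E [⋀^Fin n]→L[ℝ] ℂ}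

theorem hasWeight_fderiv_formInChart (hΩ : IsSmoothForm Ω) (hw : ∀ p, HasWeight stdJ n (Ω p))
    (x : X) (v : E) :
    HasWeight stdJ n (fderiv ℝ (formInChart x Ω) (extChartAt 𝓘(ℂ, E) x x) v) :=
  hasWeight_fderiv (differentiableAt_of_contDiffOn_chart (hΩ x))
    (.of_forall (hasWeight_formInChart x hw)) v

theorem fderiv_endoInChart_antilinear (hΦ : IsBeltrami Φ) (x : X) (u v : E) :
    fderiv ℝ (endoInChart x Φ) (extChartAt 𝓘(ℂ, E) x x) u (Complex.I • v) =
      -(Complex.I • fderiv ℝ (endoInChart x Φ) (extChartAt 𝓘(ℂ, E) x x) u v) :=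
  fderiv_antilinear (differentiableAt_of_contDiffOn_chart (hΦ.1 x))
    (.of_forall (endoInChart_antilinear x hΦ.2)) u v

theorem delbar_stdJ_eq [FiniteDimensional ℂ E] (hn : Module.finrank ℂ E = n) (hΩ : IsSmoothForm Ω)
    (hw : ∀ p, HasWeight stdJ n (Ω p)) (x : X) :
    delbar (fun _ => stdJ) Ω x = alternatizeUncurryFin
      (antiPart (fderiv ℝ (formInChart x Ω) (extChartAt 𝓘(ℂ, E) x x))) := by
  have hW := hasWeight_fderiv_formInChart hΩ hw x
  rw [delbar_eq (p := n) (q := 0) (add_zero n) (by simpa using hw), extD, extDeriv,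
    alternatizeUncurryFin_eq_linPart_add_antiPart, alternatizeUncurryFin_linPart_eq_zero hn hW,
    zero_add (alternatizeUncurryFin _)]
  apply typeProj_eq_self
  simpa using hasWeight_alternatizeUncurryFin_antilinear (antiPart_I_smul _)
    (HasWeight.antiPart hW)

theorem del_stdJ_contract_eq (hΦ : IsBeltrami Φ) (hΩ : IsSmoothForm Ω)
    (hw : ∀ p, HasWeight stdJ n (Ω p)) (x : X) :
    del (fun _ => stdJ) (fun p => contract (Φ p) (Ω p)) x = alternatizeUncurryFin
      (linPart (contractDeriv (Ω x) (fderiv ℝ (formInChart x Ω) (extChartAt 𝓘(ℂ, E) x x)) (Φ x)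
        (fderiv ℝ (endoInChart x Φ) (extChartAt 𝓘(ℂ, E) x x)))) := by
  have hm : ∀ p, IsComplexMultilinear (Ω p) := fun p => (hw p).isComplexMultilinear
  have hW := hasWeight_fderiv_formInChart hΩ hw x
  have hF := fderiv_endoInChart_antilinear hΦ x
  have hK := hasWeight_contractDeriv (hw x) hW (hΦ.2 x) hF
  cases n with
  -- For `n = 0` the contraction is zero and the type `(n - 1, 1)` does not exist.
  | zero =>
    have h0 : contractDeriv (Ω x) (fderiv ℝ (formInChart x Ω) (extChartAt 𝓘(ℂ, E) x x)) (Φ x)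
        (fderiv ℝ (endoInChart x Φ) (extChartAt 𝓘(ℂ, E) x x)) = 0 := by
      ext1 v
      rw [contractDeriv_apply, fderivCompContinuousLinearMap_of_isEmpty]
      simp
    have h1 : (fun p => contract (Φ p) (Ω p)) = fun _ => 0 := rfl
    have h2 : linPart (0 : E →L[ℝ] E [⋀^Fin 0]→L[ℝ] ℂ) = 0 := by
      ext1 v
      simp [linPart_apply]
    rw [h0, h1, h2, del_eq (p := 0) (q := 0) rfl (fun _ => HasWeight.zero _ _), extD_zero]
    exact (typeProj_eq_self (HasWeight.zero _ _)).trans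
      (_root_.map_zero (alternatizeUncurryFinCLM ℝ E ℂ)).symm
  | succ m =>
    have hc : ∀ p, HasWeight stdJ ((m : ℤ) - (1 : ℕ)) (contract (Φ p) (Ω p)) := by
      intro p
      rw [(hm p).contract_eq, derivationCLM_apply]
      have := (hw p).fderivComp_antilinear (hΦ.2 p)
      convert this using 1
      push_cast
      ring
    rw [del_eq (p := m) (q := 1) rfl hc]
    have h3 : formInChart x (fun p => contract (Φ p) (Ω p)) =ᶠ[𝓝 (extChartAt 𝓘(ℂ, E) x x)]
        fun y => derivationCLM (endoInChart x Φ y) (formInChart x Ω y) :=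
      Filter.eventually_of_mem (chart_target_mem_nhds x) fun y hy => formInChart_contract hm hy
    rw [extD, h3.extDeriv_eq, extDeriv, fderiv_derivationCLM
      (differentiableAt_of_contDiffOn_chart (hΩ x))
      (differentiableAt_of_contDiffOn_chart (hΦ.1 x)), formInChart_self, endoInChart_self,
      alternatizeUncurryFin_eq_linPart_add_antiPart]
    -- The `∂`-part has weight `n - 1`, which is kept, and the `∂̄`-part has weight `n - 3`, which
    -- the projection removes.
    refine typeProj_add_of_hasWeight (w := (m + 1 : ℕ) - 2 - 1) ?_
      (hasWeight_alternatizeUncurryFin_antilinear (antiPart_I_smul _) (HasWeight.antiPart hK))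
      (by push_cast; omega)
    have h4 := hasWeight_alternatizeUncurryFin_linear (linPart_I_smul _) (HasWeight.linPart hK)
    convert h4 using 1
    push_cast
    ring

theorem hasWeight_obstructionAt (hΩ : IsSmoothForm Ω) (hw : ∀ p, HasWeight stdJ n (Ω p)) (x : X)
    (v : E) : HasWeight stdJ n (obstructionAt Φ Ω x v) :=
  hasWeight_obstruction (hw x) (hasWeight_fderiv_formInChart hΩ hw x) v

theorem delbar_add_del_contract_eq [FiniteDimensional ℂ E] (hn : Module.finrank ℂ E = n)
    (hΦ : IsBeltrami Φ) (hΩ : IsSmoothForm Ω) (hw : ∀ p, HasWeight stdJ n (Ω p)) (x : X) :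
    delbar (fun _ => stdJ) Ω x + del (fun _ => stdJ) (fun p => contract (Φ p) (Ω p)) x =
      alternatizeUncurryFin (obstructionAt Φ Ω x) := by
  rw [delbar_stdJ_eq hn hΩ hw, del_stdJ_contract_eq hΦ hΩ hw]
  exact alternatize_antiPart_add_alternatize_linPart_contractDeriv (hw x).isComplexMultilinear
    (alternatizeUncurryFin_linPart_eq_zero hn (hasWeight_fderiv_formInChart hΩ hw x))

theorem hasWeight_expContract (hΦ : IsBeltrami Φ) (hnd : ∀ x, Nondegenerate (Φ x))
    (hw : ∀ p, HasWeight stdJ n (Ω p)) (x : X) :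
    HasWeight (inducedJ (Φ x)) n (expContract (Φ x) (Ω x)) := by
  rw [(hw x).isComplexMultilinear.expContract_eq (hΦ.2 x)]
  exact (hw x).comp (one_add_comp_inducedJ (hnd x))

theorem delbar_inducedJ_expContract_eq [FiniteDimensional ℂ E] (hn : Module.finrank ℂ E = n)
    (hΦ : IsBeltrami Φ) (hint : IsIntegrable Φ) (hnd : ∀ x, Nondegenerate (Φ x))
    (hΩ : IsSmoothForm Ω) (hw : ∀ p, HasWeight stdJ n (Ω p)) (x : X) :
    delbar (fun x => inducedJ (Φ x)) (fun p => expContract (Φ p) (Ω p)) x =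
      alternatizeUncurryFin
        (compContinuousLinearMapCLM (.id ℝ E + Φ x) ∘L obstructionAt Φ Ω x) := by
  have hm : ∀ p, IsComplexMultilinear (Ω p) := fun p => (hw p).isComplexMultilinear
  have h1 : formInChart x (fun p => expContract (Φ p) (Ω p)) =ᶠ[𝓝 (extChartAt 𝓘(ℂ, E) x x)]
      fun y => (formInChart x Ω y).compContinuousLinearMap (.id ℝ E + endoInChart x Φ y) :=
    Filter.eventually_of_mem (chart_target_mem_nhds x) fun y hy =>
      formInChart_expContract hΦ.2 hm hy
  have h2 : extD (fun p => expContract (Φ p) (Ω p)) x = alternatizeUncurryFin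
      (compContinuousLinearMapCLM (.id ℝ E + Φ x) ∘L obstructionAt Φ Ω x) := by
    rw [extD, h1.extDeriv_eq, extDeriv_pullback_one_add
      (differentiableAt_of_contDiffOn_chart (hΩ x))
      (differentiableAt_of_contDiffOn_chart (hΦ.1 x)), formInChart_self, endoInChart_self]
    exact alternatize_pullback_deriv (alternatizeUncurryFin_linPart_eq_zero hn
      (hasWeight_fderiv_formInChart hΩ hw x)) (hint.symm x)
  -- The whole of `d` already has type `(n, 1)` for `J_Φ`, so the projection defining `∂̄` leaves it
  -- unchanged.
  have h3 : HasWeight (inducedJ (Φ x)) ((n : ℤ) - (0 + 1 : ℕ)) (alternatizeUncurryFin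
      (compContinuousLinearMapCLM (.id ℝ E + Φ x) ∘L obstructionAt Φ Ω x)) := by
    rw [zero_add, Nat.cast_one]
    exact hasWeight_alternatize_pullback hn (hnd x) (hasWeight_obstructionAt hΩ hw x)
  rw [delbar_eq (p := n) (q := 0) (add_zero n) (by simpa using hasWeight_expContract hΦ hnd hw),
    h2, typeProj_eq_self h3]

theorem isSmoothForm_expContract (hΦ : IsBeltrami Φ) (hΩ : IsSmoothForm Ω)
    (hw : ∀ p, HasWeight stdJ n (Ω p)) : IsSmoothForm (fun p => expContract (Φ p) (Ω p)) :=
  fun x => (contDiffOn_pullback (hΩ x) (contDiffOn_const.add (hΦ.1 x))).congr fun _ hy =>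
    formInChart_expContract hΦ.2 (fun p => (hw p).isComplexMultilinear) hy

end Manifold

end CplxDeform

end

theorem mainTheorem10 {E : Type*} [NormedAddCommGroup E] [NormedSpace ℂ E] [FiniteDimensional ℂ E]
    {X : Type*} [TopologicalSpace X] [ChartedSpace E X] [IsManifold 𝓘(ℂ, E) ω X]
    (n : ℕ) (hn : Module.finrank ℂ E = n)
    (Φ : X → E →L[ℝ] E) (hΦ : CplxDeform.IsBeltrami Φ) (hint : CplxDeform.IsIntegrable Φ)
    (hnd : ∀ x, CplxDeform.Nondegenerate (Φ x))
    (Ω : X → E [⋀^Fin n]→L[ℝ] ℂ)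
    (hΩ : CplxDeform.IsSmoothFormOfType (fun _ => CplxDeform.stdJ) n 0 Ω) :
    CplxDeform.IsSmoothFormOfType (fun x => CplxDeform.inducedJ (Φ x)) n 0
        (fun x => CplxDeform.expContract (Φ x) (Ω x)) ∧
      (CplxDeform.IsHolomorphicForm (fun x => CplxDeform.inducedJ (Φ x))
          (fun x => CplxDeform.expContract (Φ x) (Ω x)) ↔
        ∀ x, CplxDeform.delbar (fun _ => CplxDeform.stdJ) Ω x
          + CplxDeform.del (fun _ => CplxDeform.stdJ)
              (fun y => CplxDeform.contract (Φ y) (Ω y)) x = 0) := by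
  have hw : ∀ p, CplxDeform.HasWeight CplxDeform.stdJ n (Ω p) := fun p => by
    simpa using (CplxDeform.isOfType_iff.1 (hΩ.2 p)).2
  have htype : CplxDeform.IsSmoothFormOfType (fun x => CplxDeform.inducedJ (Φ x)) n 0
      (fun x => CplxDeform.expContract (Φ x) (Ω x)) :=
    ⟨CplxDeform.isSmoothForm_expContract hΦ hΩ.1 hw, fun x => CplxDeform.isOfType_iff.2
      ⟨add_zero n, by simpa using CplxDeform.hasWeight_expContract hΦ hnd hw x⟩⟩
  refine ⟨htype, (and_iff_right htype).trans (forall_congr' fun x => ?_)⟩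
  rw [CplxDeform.delbar_inducedJ_expContract_eq hn hΦ hint hnd hΩ.1 hw,
    CplxDeform.delbar_add_del_contract_eq hn hΦ hΩ.1 hw]
  exact CplxDeform.alternatize_pullback_eq_zero_iff hn (hnd x) (hΦ.2 x)
    (CplxDeform.hasWeight_obstructionAt hΩ.1 hw x)
    (CplxDeform.obstruction_I_smul (hw x) (hΦ.2 x)
      (CplxDeform.fderiv_endoInChart_antilinear hΦ x))
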